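/- Let $p_1=2,p_2=3,\dots$ be the primes in increasing order, and let $m_\infty$ be the normalized Haar measure on the infinite torus $\mathbb{T}^\infty$. For $2\le p<\infty$, let $H^p(\mathbb{D}^\infty)$ be the closure in $L^p(\mathbb{T}^\infty,m_\infty)$ of the polynomials in finitely many of the variables $z_1,z_2,\dots$. For $\tau\in\mathbb{T}^\infty$, $\theta\ge 0$ and $t\in\mathbb{R}$ put \[ b_\theta(\tau)=(p_1^{-\theta}\tau_1,p_2^{-\theta}\tau_2,\dots),\qquad T_t(\tau)=(p_1^{-it}\tau_1,p_2^{-it}\tau_2,\dots). \] Let $F\in H^p(\mathbb{D}^\infty)$. (a) For every $z\in\mathbb{D}^\infty\cap\ell^2$ the value $F(z):=\lim P(z)$ is well defined, where the limit is taken as the polynomial $P$ tends to $F$ in $L^p(\mathbb{T}^\infty,m_\infty)$. Likewise the restriction $F|_{\mathbb{T}^\infty_{1/2}}$ of $F$ to $\mathbb{T}^\infty_{1/2}=b_{1/2}(\mathbb{T}^\infty)$, viewed through $b_{1/2}$ as an element of $L^p(\mathbb{T}^\infty,m_\infty)$ and defined as the $L^p$-limit of $P\circ b_{1/2}$ as $P\to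 F$, is well defined. (b) The restriction $F|_{\mathbb{T}^\infty_{1/2}}$ has a Borel measurable representative $\widetilde F_{1/2}:\mathbb{T}^\infty\to\mathbb{C}$ such that, for $m_\infty$-almost every $\tau\in\mathbb{T}^\infty$, the limit $\lim_{\theta\to 1/2^+}F(b_\theta(\tau))$ exists and equals $\widetilde F_{1/2}(\tau)$; moreover, with the same representative, for every $\tau\in\mathbb{T}^\infty$ and Lebesgue-almost every $t\in\mathbb{R}$ the limit $\lim_{\theta\to 1/2^+}F(b_\theta(T_t(\tau)))$ exists and equals $\widetilde F_{1/2}(T_t(\tau))$. -/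

import Mathlib

open MeasureTheory Filter Topology
open scoped ENNReal

noncomputable section

namespace HardyTorus

/-- The infinite torus `𝕋^∞`, a compact group under the product topology. Coordinates are
indexed from `0`. -/
abbrev Torus : Type := ℕ → Circle

/-- The Borel sigma-algebra on the circle. -/
instance : MeasurableSpace Circle := borel Circle

instance : BorelSpace Circle := ⟨rfl⟩

/-- The normalized Haar measure `m_∞` of the infinite torus. -/
def haar : Measure Torus := Measure.haarMeasure ⊤

instance : haar.IsHaarMeasure := by unfold haar; infer_instance

instance : IsProbabilityMeasure haar :=
  ⟨by simpa [haar] using Measure.haarMeasure_self (K₀ := (⊤ : TopologicalSpace.PositiveCompacts Torus))⟩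

/-- The primes in increasing order: `primeSeq 0 = 2`, `primeSeq 1 = 3`, … -/
def primeSeq (j : ℕ) : ℕ := Nat.nth Nat.Prime j

/-- The map `b_θ(τ) = (p₁^{-θ} τ₁, p₂^{-θ} τ₂, …)` from the torus to sequences of complex
numbers. -/
def boundaryMap (θ : ℝ) (τ : Torus) : ℕ → ℂ :=
  fun j => (((primeSeq j : ℝ) ^ (-θ) : ℝ) : ℂ) * (τ j : ℂ)

/-- The Kronecker flow `T_t(τ) = (p₁^{-it} τ₁, p₂^{-it} τ₂, …)` on the torus. -/
def kroneckerFlow (t : ℝ) (τ : Torus) : Torus :=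
  fun j => Circle.exp (-t * Real.log (primeSeq j)) * τ j

theorem continuous_boundaryMap_apply (θ : ℝ) (j : ℕ) :
    Continuous fun τ : Torus => boundaryMap θ τ j := by
  unfold boundaryMap
  fun_prop

/-- For a polynomial `P` in the variables `z₁, z₂, …`, the continuous function
`τ ↦ P(b_θ(τ))` on the torus. -/
def polyMap (θ : ℝ) : MvPolynomial ℕ ℂ →ₐ[ℂ] C(Torus, ℂ) :=
  MvPolynomial.aeval fun j => ⟨fun τ => boundaryMap θ τ j, continuous_boundaryMap_apply θ j⟩

theorem polyMap_apply (θ : ℝ) (P : MvPolynomial ℕ ℂ) (τ : Torus) :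
    polyMap θ P τ = MvPolynomial.eval (boundaryMap θ τ) P := by
  induction P using MvPolynomial.induction_on with
  | C a => simp [polyMap, Algebra.algebraMap_eq_smul_one]
  | add P Q hP hQ => simp [hP, hQ]
  | mul_X P j hP =>
    rw [map_mul, ContinuousMap.mul_apply, hP]
    simp [polyMap]

theorem boundaryMap_zero (τ : Torus) : boundaryMap 0 τ = fun j => (τ j : ℂ) := by
  funext j
  simp [boundaryMap]

/-- The class of `τ ↦ P(b_θ(τ))` in `L^p(𝕋^∞, m_∞)`. For `θ = 0` it is the class of `P`
itself on the torus. -/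
def polyLp (p : ℝ≥0∞) [Fact (1 ≤ p)] (θ : ℝ) : MvPolynomial ℕ ℂ →ₗ[ℂ] Lp ℂ p haar :=
  (ContinuousMap.toLp (E := ℂ) p haar ℂ).toLinearMap ∘ₗ (polyMap θ).toLinearMap

/-- The Hardy space `H^p(𝔻^∞)`, `1 ≤ p < ∞`: the closure of the polynomials with respect to
the norm of `L^p(𝕋^∞, m_∞)`. -/
def hardySpace (p : ℝ≥0∞) [Fact (1 ≤ p)] : Submodule ℂ (Lp ℂ p haar) :=
  (LinearMap.range (polyLp p 0)).topologicalClosure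

/-- The filter describing polynomials `P` that converge to `F` in the norm of
`L^p(𝕋^∞, m_∞)`. -/
def approx {p : ℝ≥0∞} [Fact (1 ≤ p)] (F : Lp ℂ p haar) : Filter (MvPolynomial ℕ ℂ) :=
  comap (polyLp p 0) (𝓝 F)

theorem approx_neBot_iff {p : ℝ≥0∞} [Fact (1 ≤ p)] (F : Lp ℂ p haar) :
    (approx F).NeBot ↔ F ∈ hardySpace p := by
  rw [approx, hardySpace, ← SetLike.mem_coe, Submodule.topologicalClosure_coe,
    LinearMap.coe_range, mem_closure_iff_comap_neBot, comap_neBot_iff, comap_neBot_iff]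
  constructor
  · intro h t ht
    obtain ⟨P, hP⟩ := h t ht
    exact ⟨⟨_, P, rfl⟩, hP⟩
  · intro h t ht
    obtain ⟨⟨_, P, rfl⟩, hP⟩ := h t ht
    exact ⟨P, hP⟩

/-- The value `F(z)` of `F ∈ H^p(𝔻^∞)` at a point `z`, obtained by extending the point
evaluation at `z` continuously from the polynomials: the limit of `P(z)` as the polynomial `P`
tends to `F` in `H^p(𝔻^∞)`. -/
def value {p : ℝ≥0∞} [Fact (1 ≤ p)] (F : Lp ℂ p haar) (z : ℕ → ℂ) : ℂ :=
  limUnder (approx F) fun P => MvPolynomial.eval z P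

/-- The restriction of `F ∈ H^p(𝔻^∞)` to `𝕋^∞_θ = b_θ(𝕋^∞)`, regarded through `b_θ` as an
element of `L^p(𝕋^∞, m_∞)`: the continuous extension of `P ↦ P ∘ b_θ` from the polynomials. -/
def restriction {p : ℝ≥0∞} [Fact (1 ≤ p)] (θ : ℝ) (F : Lp ℂ p haar) : Lp ℂ p haar :=
  limUnder (approx F) fun P => polyLp p θ P

end HardyTorus

end

/-!
The proof rests on the Poisson kernel `k_y(u) = π⁻¹ y / (y² + u²)` of the half-plane, whose Fourier
transform is `e^{-y|λ|}`. Under the Bohr correspondence a polynomial `P = ∑ c_d z^d` becomes, on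
the orbit of `τ` under the Kronecker flow, the Dirichlet polynomial
`P(b_θ(T_t τ)) = ∑ c_d τ^d n_d^{-θ-it}` with `n_d = ∏ pⱼ^{dⱼ}`. Since
`n^{-y} = ∫ k_y(u) n^{-iu} du`,
averaging `P ∘ b_σ` along the flow against `k_y` gives `P ∘ b_{σ+y}`
(`integral_poissonKernel_mul_eval`). This identity is used in two ways.

The flow preserves Haar measure, so with `σ = 0` the identity shows that `P ↦ P ∘ b_θ` is a
contraction in every `L^p` norm (`norm_polyLp_le`); hence restrictions are well defined and
continuous in `θ`. Point evaluations in `𝔻^∞ ∩ ℓ²` are bounded by Parseval's identity and the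
Cauchy–Schwarz inequality (`norm_eval_le`), so values are well defined too.

With `σ = 1/2` the identity represents `F` on each orbit as a Poisson integral. The boundary values
of polynomials on an orbit are bounded in `L²(k_1(u) du)` by the `ℓ²` norm of the coefficients:
the Gram matrix of the functions `n^{-1/2-iu}` is `(mn)^{-1/2} min(m/n, n/m)`, whose rows have
bounded sums, and Schur's test applies (`integral_poissonKernel_mul_norm_sq_le`). Therefore they
converge to a boundary function `g` on the orbit of *every* `τ`, and
`F(b_{1/2+y}(T_t τ)) = ∫ k_y(u - t) g(u) du` (`exists_value_eq_integral_poissonKernel`). Poisson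
integrals converge at Lebesgue points (`ae_tendsto_integral_poissonKernel`), so the radial limit
exists at `T_t τ` for almost every `t`.

The set of `τ` at which the radial limit exists is measurable, because `θ ↦ F(b_θ(τ))` is continuous
and rational `θ` suffice. It contains almost every point of every orbit, so by Fubini's theorem and
invariance it has full measure (`ae_mem_of_forall_ae_kroneckerFlow`). The representative is the
limit along `θ = 1/2 + 1/(n+1)`; it agrees almost everywhere with the restriction because
`F ∘ b_θ` tends to the restriction in `L^p` as `θ → 1/2`.
-/

noncomputable section

namespace HardyTorus

/-! ### The Poisson kernel of the half-plane -/

/-- The Poisson kernel `π⁻¹ y / (y² + u²)` of the upper half-plane at height `y`. -/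
def poissonKernel (y u : ℝ) : ℝ := Real.pi⁻¹ * (y / (y ^ 2 + u ^ 2))

theorem poissonKernel_nonneg {y : ℝ} (hy : 0 ≤ y) (u : ℝ) : 0 ≤ poissonKernel y u := by
  unfold poissonKernel
  positivity

theorem poissonKernel_pos {y : ℝ} (hy : 0 < y) (u : ℝ) : 0 < poissonKernel y u := by
  unfold poissonKernel
  positivity

theorem continuous_poissonKernel {y : ℝ} (hy : 0 < y) : Continuous (poissonKernel y) := by
  unfold poissonKernel
  have : ∀ u : ℝ, y ^ 2 + u ^ 2 ≠ 0 := fun u => by positivity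
  fun_prop (disch := exact this _)

/-- All Poisson kernels are dilations of the one at height `1`. -/
theorem poissonKernel_eq_dilation {y : ℝ} (hy : 0 < y) (u : ℝ) :
    poissonKernel y u = y⁻¹ * poissonKernel 1 (u / y) := by
  unfold poissonKernel
  field_simp

theorem integrable_poissonKernel {y : ℝ} (hy : 0 < y) : Integrable (poissonKernel y) := by
  have h1 : Integrable (poissonKernel 1) := by
    refine (integrable_inv_one_add_sq.const_mul Real.pi⁻¹).congr (ae_of_all _ fun u => ?_)
    simp [poissonKernel]
  refine ((h1.comp_div hy.ne').const_mul y⁻¹).congr (ae_of_all _ fun u => ?_)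
  exact (poissonKernel_eq_dilation hy u).symm

open FourierTransform in
/-- The Fourier transform of `e^{-2π|x|}` is the Poisson kernel at height `1`, so that Fourier
inversion yields the transform of the kernel itself. -/
theorem fourier_exp_neg_abs (ξ : ℝ) :
    𝓕 (fun x : ℝ => Complex.exp (-(2 * Real.pi * |x| : ℝ))) ξ = (poissonKernel 1 ξ : ℂ) := by
  have hpi := Real.pi_pos
  rw [Real.fourier_eq']
  have hL : ∀ x ∈ Set.Iic (0 : ℝ), Complex.exp ((-2 * Real.pi * inner ℝ x ξ : ℝ) * Complex.I) •
      Complex.exp (-(2 * Real.pi * |x| : ℝ)) =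
      Complex.exp ((2 * Real.pi * (1 - ξ * Complex.I)) * x) := by
    intro x hx
    rw [smul_eq_mul, ← Complex.exp_add, abs_of_nonpos hx]
    congr 1
    simp
    ring
  have hR : ∀ x ∈ Set.Ioi (0 : ℝ), Complex.exp ((-2 * Real.pi * inner ℝ x ξ : ℝ) * Complex.I) •
      Complex.exp (-(2 * Real.pi * |x| : ℝ)) =
      Complex.exp ((-(2 * Real.pi * (1 + ξ * Complex.I))) * x) := by
    intro x hx
    rw [smul_eq_mul, ← Complex.exp_add, abs_of_pos hx]
    congr 1
    simp
    ring
  have h1 : 0 < (2 * Real.pi * (1 - ξ * Complex.I)).re := by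
    simp [hpi]
  have h2 : (-(2 * Real.pi * (1 + ξ * Complex.I))).re < 0 := by
    simp [hpi]
  rw [← intervalIntegral.integral_Iic_add_Ioi (b := 0), setIntegral_congr_fun measurableSet_Iic hL,
    setIntegral_congr_fun measurableSet_Ioi hR, integral_exp_mul_complex_Iic h1,
    integral_exp_mul_complex_Ioi h2]
  · have e1 : (1 - ξ * Complex.I) ≠ 0 := by
      intro h
      rw [h] at h1
      simp at h1
    have e2 : (1 + ξ * Complex.I) ≠ 0 := by
      intro h
      rw [h] at h2
      simp at h2
    have e3 : (1 : ℂ) + ξ ^ 2 ≠ 0 := by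
      have : (1 : ℂ) + ξ ^ 2 = (1 - ξ * Complex.I) * (1 + ξ * Complex.I) := by
        linear_combination (ξ : ℂ) ^ 2 * Complex.I_sq
      rw [this]
      exact mul_ne_zero e1 e2
    have e4 : (Real.pi : ℂ) ≠ 0 := by exact_mod_cast hpi.ne'
    simp [poissonKernel]
    field_simp
    linear_combination (2 * (ξ : ℂ) ^ 2) * Complex.I_sq
  · exact (integrableOn_exp_mul_complex_Iic h1 0).congr_fun (fun x hx => (hL x hx).symm)
      measurableSet_Iic
  · exact (integrableOn_exp_mul_complex_Ioi h2 0).congr_fun (fun x hx => (hR x hx).symm)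
      measurableSet_Ioi

/-- The Fourier transform of the Poisson kernel. -/
theorem integral_poissonKernel_mul_exp {y : ℝ} (hy : 0 < y) (l : ℝ) :
    ∫ u : ℝ, (poissonKernel y u : ℂ) * Complex.exp (-(l * u : ℝ) * Complex.I) =
      (Real.exp (-(y * |l|)) : ℂ) := by
  have hpi := Real.pi_pos
  set f : ℝ → ℂ := fun x : ℝ => Complex.exp (-(2 * Real.pi * |x| : ℝ)) with hf
  have hFf : FourierTransform.fourier f = fun ξ => (poissonKernel 1 ξ : ℂ) :=
    funext fourier_exp_neg_abs
  have hcont : Continuous f := by fun_prop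
  have hint : Integrable f := by
    rw [← integrableOn_univ, ← Set.Iic_union_Ioi (a := (0 : ℝ))]
    refine IntegrableOn.union ?_ ?_
    · refine (integrableOn_exp_mul_complex_Iic (a := (2 * Real.pi : ℝ))
        (by simpa using hpi) 0).congr_fun (fun x hx => ?_) measurableSet_Iic
      simp only [hf]
      rw [abs_of_nonpos hx]
      push_cast
      ring_nf
    · refine (integrableOn_exp_mul_complex_Ioi (a := (-(2 * Real.pi) : ℝ))
        (by simpa using hpi) 0).congr_fun (fun x hx => ?_) measurableSet_Ioi
      simp only [hf]
      rw [abs_of_pos hx]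
      push_cast
      ring_nf
  have hinv := hcont.fourierInv_fourier_eq hint
    (by rw [hFf]; exact (integrable_poissonKernel one_pos).ofReal)
  have key := congrFun hinv (-(l * y) / (2 * Real.pi))
  rw [hFf, Real.fourierInv_eq'] at key
  have hs : ∫ u : ℝ, (poissonKernel y u : ℂ) * Complex.exp (-(l * u : ℝ) * Complex.I) =
      ∫ u : ℝ, (y⁻¹ : ℝ) • ((poissonKernel 1 (u / y) : ℂ) *
        Complex.exp (-(l * y * (u / y) : ℝ) * Complex.I)) := by
    congr 1
    ext u
    rw [poissonKernel_eq_dilation hy, Complex.real_smul]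
    have : l * y * (u / y) = l * u := by field_simp
    rw [this]
    push_cast
    ring
  rw [hs, integral_smul, Measure.integral_comp_div (fun v : ℝ => (poissonKernel 1 v : ℂ) *
        Complex.exp (-(l * y * v : ℝ) * Complex.I)) y, smul_smul, abs_of_pos hy,
    inv_mul_cancel₀ hy.ne', one_smul]
  convert key using 1
  · congr 1
    ext v
    rw [smul_eq_mul, mul_comm]
    congr 2
    simp
    field_simp
  · simp only [hf]
    rw [← Complex.ofReal_neg, ← Complex.ofReal_exp]
    congr 3
    rw [abs_div, abs_neg, abs_mul, abs_of_pos hy, abs_of_pos (by positivity : 0 < 2 * Real.pi)]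
    field_simp

/-! ### Dirichlet series in Bohr coordinates -/

theorem primeSeq_prime (j : ℕ) : (primeSeq j).Prime := Nat.prime_nth_prime j

theorem primeSeq_injective : Function.Injective primeSeq :=
  Nat.nth_injective Nat.infinite_setOfPred_prime

/-- The positive integer `∏ pⱼ ^ dⱼ` with exponent vector `d` (the Bohr correspondence). -/
def bohrIndex (d : ℕ →₀ ℕ) : ℕ := d.prod fun j k => primeSeq j ^ k

theorem bohrIndex_pos (d : ℕ →₀ ℕ) : 0 < bohrIndex d :=
  Finset.prod_pos fun j _ => pow_pos (primeSeq_prime j).pos _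

theorem bohrIndex_injective : Function.Injective bohrIndex := by
  intro d e h
  have key : ∀ d : ℕ →₀ ℕ, (bohrIndex d).factorization = d.mapDomain primeSeq := by
    intro d
    rw [← Nat.prod_pow_factorization_eq_self (f := d.mapDomain primeSeq)]
    · rw [Finsupp.prod_mapDomain_index_inj primeSeq_injective, bohrIndex]
    · intro p hp
      have := Finsupp.mapDomain_support hp
      obtain ⟨j, -, rfl⟩ := Finset.mem_image.1 this
      exact primeSeq_prime j
  apply Finsupp.mapDomain_injective primeSeq_injective
  rw [← key, ← key, h]

/-- The character `τ ↦ ∏ τⱼ ^ dⱼ` of the infinite torus. -/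
def torusChar (d : ℕ →₀ ℕ) (τ : Torus) : ℂ := d.prod fun j k => (τ j : ℂ) ^ k

theorem continuous_torusChar (d : ℕ →₀ ℕ) : Continuous (torusChar d) := by
  unfold torusChar Finsupp.prod
  fun_prop

theorem norm_torusChar (d : ℕ →₀ ℕ) (τ : Torus) : ‖torusChar d τ‖ = 1 := by
  rw [torusChar, Finsupp.prod, norm_prod]
  exact Finset.prod_eq_one fun j _ => by rw [norm_pow, Circle.norm_coe, one_pow]

theorem torusChar_mul (d : ℕ →₀ ℕ) (τ ρ : Torus) :
    torusChar d (τ * ρ) = torusChar d τ * torusChar d ρ := by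
  simp [torusChar, Finsupp.prod, mul_pow, Finset.prod_mul_distrib]

theorem log_bohrIndex (d : ℕ →₀ ℕ) :
    Real.log (bohrIndex d) = ∑ j ∈ d.support, d j * Real.log (primeSeq j) := by
  rw [bohrIndex, Finsupp.prod, Nat.cast_prod, Real.log_prod]
  · simp
  · intro j _
    have := (primeSeq_prime j).pos
    positivity

theorem kroneckerFlow_eq_mul (t : ℝ) (τ : Torus) :
    kroneckerFlow t τ = kroneckerFlow t 1 * τ := by
  funext j
  simp [kroneckerFlow]

theorem torusChar_kroneckerFlow (d : ℕ →₀ ℕ) (t : ℝ) (τ : Torus) :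
    torusChar d (kroneckerFlow t τ) =
      Complex.exp (-(Real.log (bohrIndex d) * t : ℝ) * Complex.I) * torusChar d τ := by
  rw [kroneckerFlow_eq_mul, torusChar_mul]
  congr 1
  simp only [torusChar, Finsupp.prod, kroneckerFlow, Pi.one_apply, mul_one, Circle.coe_exp,
    ← Complex.exp_nat_mul, ← Complex.exp_sum]
  rw [log_bohrIndex]
  push_cast
  rw [Finset.sum_mul, ← Finset.sum_neg_distrib, Finset.sum_mul]
  congr 1
  refine Finset.sum_congr rfl fun j _ => ?_
  ring

/-- In Bohr coordinates a polynomial on `b_θ(𝕋^∞)` is a Dirichlet polynomial. -/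
theorem eval_boundaryMap (θ : ℝ) (τ : Torus) (P : MvPolynomial ℕ ℂ) :
    MvPolynomial.eval (boundaryMap θ τ) P =
      ∑ d ∈ P.support, P.coeff d * (((bohrIndex d : ℝ) ^ (-θ) : ℝ) : ℂ) * torusChar d τ := by
  rw [MvPolynomial.eval_eq]
  refine Finset.sum_congr rfl fun d _ => ?_
  rw [mul_assoc]
  congr 1
  simp only [boundaryMap, mul_pow, Finset.prod_mul_distrib]
  rw [torusChar, Finsupp.prod]
  congr 1
  rw [bohrIndex, Finsupp.prod, Nat.cast_prod, ← Real.finsetProd_rpow]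
  · push_cast
    refine Finset.prod_congr rfl fun j _ => ?_
    rw [← Complex.ofReal_pow, Real.rpow_pow_comm (by positivity)]
  · intro j _
    positivity

/-! ### Parseval's identity -/

theorem integrable_of_continuous {f : Torus → ℂ} (hf : Continuous f) : Integrable f haar :=
  hf.integrable_of_hasCompactSupport (HasCompactSupport.of_compactSpace f)

/-- The characters of the infinite torus are orthonormal. -/
theorem integral_torusChar_mul_conj (d e : ℕ →₀ ℕ) :
    ∫ τ, torusChar d τ * starRingEnd ℂ (torusChar e τ) ∂haar = if d = e then 1 else 0 := by
  split_ifs with h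
  · subst h
    simp [Complex.mul_conj, Complex.normSq_eq_norm_sq, norm_torusChar]
  · -- translate by a point of the Kronecker flow at which the two characters differ
    have hl : Real.log (bohrIndex e) - Real.log (bohrIndex d) ≠ 0 := by
      intro h0
      apply h
      apply bohrIndex_injective
      have := Real.log_injOn_pos (Set.mem_Ioi.2 (Nat.cast_pos.2 (bohrIndex_pos d)))
        (Set.mem_Ioi.2 (Nat.cast_pos.2 (bohrIndex_pos e))) (sub_eq_zero.1 h0).symm
      exact_mod_cast this
    set l := Real.log (bohrIndex e) - Real.log (bohrIndex d) with hldef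
    set t : ℝ := Real.pi / l with ht
    have hshift : ∀ τ : Torus, torusChar d (kroneckerFlow t 1 * τ) *
        starRingEnd ℂ (torusChar e (kroneckerFlow t 1 * τ)) =
        -(torusChar d τ * starRingEnd ℂ (torusChar e τ)) := by
      intro τ
      rw [← kroneckerFlow_eq_mul, torusChar_kroneckerFlow, torusChar_kroneckerFlow, map_mul,
        ← Complex.exp_conj]
      have : Complex.exp (-(Real.log (bohrIndex d) * t : ℝ) * Complex.I) *
          Complex.exp (starRingEnd ℂ (-(Real.log (bohrIndex e) * t : ℝ) * Complex.I)) = -1 := by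
        rw [← Complex.exp_add, ← Complex.exp_pi_mul_I]
        congr 1
        have hlt : l * t = Real.pi := by rw [ht]; field_simp
        rw [← hlt, hldef]
        simp only [map_mul, map_neg, Complex.conj_ofReal, Complex.conj_I]
        push_cast
        ring
      linear_combination (torusChar d τ * starRingEnd ℂ (torusChar e τ)) * this
    have hinv := integral_mul_left_eq_self (μ := haar)
      (fun τ => torusChar d τ * starRingEnd ℂ (torusChar e τ)) (kroneckerFlow t 1)
    simp only [hshift, integral_neg] at hinv
    exact self_eq_neg.1 hinv.symm

/-- Parseval's identity for polynomials on the infinite torus. -/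
theorem integral_norm_sq_polyMap (P : MvPolynomial ℕ ℂ) :
    ∫ τ, ‖polyMap 0 P τ‖ ^ 2 ∂haar = ∑ d ∈ P.support, ‖P.coeff d‖ ^ 2 := by
  have hexp : ∀ τ, ((‖polyMap 0 P τ‖ ^ 2 : ℝ) : ℂ) = ∑ d ∈ P.support, ∑ e ∈ P.support,
      P.coeff d * starRingEnd ℂ (P.coeff e) *
        (torusChar d τ * starRingEnd ℂ (torusChar e τ)) := by
    intro τ
    rw [← Complex.normSq_eq_norm_sq, ← Complex.mul_conj, polyMap_apply, eval_boundaryMap, map_sum,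
      Finset.sum_mul_sum]
    refine Finset.sum_congr rfl fun d _ => Finset.sum_congr rfl fun e _ => ?_
    simp
    ring
  have hint : ∀ d e : ℕ →₀ ℕ, Integrable (fun τ => P.coeff d * starRingEnd ℂ (P.coeff e) *
      (torusChar d τ * starRingEnd ℂ (torusChar e τ))) haar := by
    intro d e
    apply integrable_of_continuous
    have := continuous_torusChar d
    have := continuous_torusChar e
    fun_prop
  have : ((∫ τ, ‖polyMap 0 P τ‖ ^ 2 ∂haar : ℝ) : ℂ) =
      ((∑ d ∈ P.support, ‖P.coeff d‖ ^ 2 : ℝ) : ℂ) := by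
    rw [← integral_complex_ofReal]
    simp_rw [hexp]
    rw [integral_finsetSum _ fun d _ => integrable_finsetSum _ fun e _ => hint d e]
    simp_rw [integral_finsetSum P.support fun e _ => hint _ e]
    simp_rw [integral_const_mul, integral_torusChar_mul_conj]
    push_cast
    refine Finset.sum_congr rfl fun d hd => ?_
    simp only [mul_ite, mul_one, mul_zero, Finset.sum_ite_eq, if_pos hd]
    rw [Complex.mul_conj, Complex.normSq_eq_norm_sq, Complex.ofReal_pow]
  exact_mod_cast this

variable {p : ℝ≥0∞} [Fact (1 ≤ p)]

theorem norm_polyLp (θ : ℝ) (P : MvPolynomial ℕ ℂ) :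
    ‖polyLp p θ P‖ = (eLpNorm (fun τ => polyMap θ P τ) p haar).toReal := by
  rw [Lp.norm_def]
  congr 1
  exact eLpNorm_congr_ae (ContinuousMap.coeFn_toLp haar _)

/-- The `ℓ²` norm of the coefficients is dominated by the `L^p` norm when `p ≥ 2`. -/
theorem sum_norm_coeff_sq_le (hp : 2 ≤ p) (P : MvPolynomial ℕ ℂ) :
    ∑ d ∈ P.support, ‖P.coeff d‖ ^ 2 ≤ ‖polyLp p 0 P‖ ^ 2 := by
  have hm : MemLp (fun τ => polyMap 0 P τ) p haar :=
    (polyMap 0 P).continuous.memLp_of_hasCompactSupport (HasCompactSupport.of_compactSpace _)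
  have hm2 : MemLp (fun τ => polyMap 0 P τ) 2 haar := hm.mono_exponent hp
  rw [← integral_norm_sq_polyMap, norm_polyLp]
  have h1 : (eLpNorm (fun τ => polyMap 0 P τ) 2 haar).toReal ^ 2 =
      ∫ τ, ‖polyMap 0 P τ‖ ^ 2 ∂haar := by
    rw [hm2.eLpNorm_eq_integral_rpow_norm two_ne_zero ENNReal.ofNat_ne_top]
    rw [ENNReal.toReal_ofReal (by positivity)]
    simp
    rw [← one_div, ← Real.sqrt_eq_rpow, Real.sq_sqrt (by positivity)]
  rw [← h1]
  gcongr
  · exact hm.eLpNorm_ne_top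
  · exact eLpNorm_le_eLpNorm_of_exponent_le hp hm.aestronglyMeasurable

/-! ### Bounded functionals on the polynomials and point evaluations -/

/-- A linear map on the polynomials that is bounded for the `L^p` norm extends to the Hardy
space: its values converge along polynomials approximating `F`. -/
theorem tendsto_limUnder_approx {E : Type*} [NormedAddCommGroup E] [NormedSpace ℂ E]
    [CompleteSpace E] {F : Lp ℂ p haar} (hF : F ∈ hardySpace p)
    (L : MvPolynomial ℕ ℂ →ₗ[ℂ] E) (C : ℝ) (hL : ∀ P, ‖L P‖ ≤ C * ‖polyLp p 0 P‖) :
    Tendsto L (approx F) (𝓝 (limUnder (approx F) L)) := by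
  have hne : (approx F).NeBot := (approx_neBot_iff F).2 hF
  refine tendsto_nhds_limUnder ?_
  refine CompleteSpace.complete (f := map L (approx F)) ?_
  rw [Metric.cauchy_iff]
  refine ⟨inferInstance, fun ε hε => ?_⟩
  have hC : 0 < |C| + 1 := by positivity
  refine ⟨L '' (polyLp p 0 ⁻¹' Metric.ball F (ε / (2 * (|C| + 1)))),
    image_mem_map (preimage_mem_comap (Metric.ball_mem_nhds _ (by positivity))), ?_⟩
  rintro _ ⟨P, hP, rfl⟩ _ ⟨Q, hQ, rfl⟩
  have hPQ : ‖polyLp p 0 (P - Q)‖ < ε / (|C| + 1) := by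
    rw [map_sub, ← dist_eq_norm]
    calc dist (polyLp p 0 P) (polyLp p 0 Q) ≤ _ := dist_triangle_right _ _ F
      _ < ε / (2 * (|C| + 1)) + ε / (2 * (|C| + 1)) := add_lt_add hP hQ
      _ = _ := by field_simp; norm_num
  rw [dist_eq_norm, ← map_sub]
  calc ‖L (P - Q)‖ ≤ C * ‖polyLp p 0 (P - Q)‖ := hL _
    _ ≤ (|C| + 1) * ‖polyLp p 0 (P - Q)‖ := by
      gcongr
      linarith [le_abs_self C]
    _ < (|C| + 1) * (ε / (|C| + 1)) := by gcongr
    _ = ε := by field_simp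

/-- Expanding the product on the right gives one monomial for each exponent vector in the box. -/
theorem sum_finsuppProd_le_prod_sum {x : ℕ → ℝ} (hx0 : ∀ j, 0 ≤ x j) {S : Finset (ℕ →₀ ℕ)}
    {I T : Finset ℕ} (hsupp : ∀ d ∈ S, d.support ⊆ I) (hmem : ∀ d ∈ S, ∀ j, d j ∈ T) :
    ∑ d ∈ S, d.prod (fun j k => x j ^ k) ≤ ∏ j ∈ I, ∑ k ∈ T, x j ^ k := by
  have hprod : ∀ d ∈ S, d.prod (fun j k => x j ^ k) = ∏ j ∈ I.attach, x j ^ d j := by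
    intro d hd
    rw [Finsupp.prod_of_support_subset d (hsupp d hd) _ (by simp)]
    exact (Finset.prod_attach I fun j => x j ^ d j).symm
  have hinj : Set.InjOn (fun (d : ℕ →₀ ℕ) (j : ℕ) (_ : j ∈ I) => d j) S := by
    intro d hd e he h
    ext j
    by_cases hj : j ∈ I
    · exact congrFun (congrFun h j) hj
    · rw [Finsupp.notMem_support_iff.1 fun h' => hj (hsupp d hd h'),
        Finsupp.notMem_support_iff.1 fun h' => hj (hsupp e he h')]
  rw [Finset.prod_sum, Finset.sum_congr rfl hprod]
  rw [← Finset.sum_image (f := fun q : (j : ℕ) → j ∈ I → ℕ => ∏ j ∈ I.attach, x j ^ q j j.2) hinj]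
  refine Finset.sum_le_sum_of_subset_of_nonneg ?_ fun q _ _ =>
    Finset.prod_nonneg fun j _ => pow_nonneg (hx0 _) _
  intro q hq
  obtain ⟨d, hd, rfl⟩ := Finset.mem_image.1 hq
  exact Finset.mem_pi.2 fun j _ => hmem d hd j

/-- The finite partial sums of `∏ⱼ (1 - xⱼ)⁻¹ = ∑_d x^d` are bounded. -/
theorem sum_finsuppProd_pow_le {x : ℕ → ℝ} (hx0 : ∀ j, 0 ≤ x j) (hx1 : ∀ j, x j < 1)
    (hx : Summable x) : ∃ C : ℝ, ∀ S : Finset (ℕ →₀ ℕ),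
      ∑ d ∈ S, d.prod (fun j k => x j ^ k) ≤ C := by
  have hsum : Summable fun j => x j * (1 - x j)⁻¹ := by
    have hev : ∀ᶠ j in cofinite, x j ≤ 1 / 2 := by
      rw [Nat.cofinite_eq_atTop]
      exact (hx.tendsto_atTop_zero.eventually (gt_mem_nhds (by norm_num : (0 : ℝ) < 1 / 2))).mono
        fun j hj => le_of_lt hj
    refine Summable.of_norm_bounded_eventually (hx.mul_right 2) ?_
    filter_upwards [hev] with j hj
    have h1 : 0 < 1 - x j := by linarith [hx1 j]
    rw [Real.norm_of_nonneg (mul_nonneg (hx0 j) (inv_nonneg.2 h1.le))]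
    gcongr
    · exact hx0 j
    · rw [inv_le_comm₀ h1 two_pos]
      linarith
  refine ⟨Real.exp (∑' j, x j * (1 - x j)⁻¹), fun S => ?_⟩
  -- enclose `S` in a finite box of exponents
  obtain ⟨I, hsupp⟩ : ∃ I : Finset ℕ, ∀ d ∈ S, d.support ⊆ I :=
    ⟨S.biUnion Finsupp.support, fun d hd => Finset.subset_biUnion_of_mem _ hd⟩
  obtain ⟨N, hmem⟩ : ∃ N : ℕ, ∀ d ∈ S, ∀ j, d j ∈ Finset.range N :=
    ⟨S.sup Finsupp.degree + 1, fun d hd j => Finset.mem_range.2 <| Nat.lt_succ_iff.2 <|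
      (Finsupp.le_degree j d).trans (Finset.le_sup hd)⟩
  calc ∑ d ∈ S, d.prod (fun j k => x j ^ k)
      ≤ ∏ j ∈ I, ∑ k ∈ Finset.range N, x j ^ k := sum_finsuppProd_le_prod_sum hx0 hsupp hmem
    _ ≤ ∏ j ∈ I, Real.exp (x j * (1 - x j)⁻¹) := by
      refine Finset.prod_le_prod (fun j _ => Finset.sum_nonneg fun k _ => pow_nonneg (hx0 j) k)
        fun j _ => ?_
      have h1 : 1 - x j ≠ 0 := by linarith [hx1 j]
      calc ∑ k ∈ Finset.range N, x j ^ k ≤ ∑' k, x j ^ k :=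
            (summable_geometric_of_lt_one (hx0 j) (hx1 j)).sum_le_tsum _
              fun k _ => pow_nonneg (hx0 j) k
        _ = x j * (1 - x j)⁻¹ + 1 := by
            rw [tsum_geometric_of_lt_one (hx0 j) (hx1 j)]
            field_simp
            ring
        _ ≤ _ := Real.add_one_le_exp _
    _ = Real.exp (∑ j ∈ I, x j * (1 - x j)⁻¹) := (Real.exp_sum _ _).symm
    _ ≤ _ := by
      gcongr
      exact hsum.sum_le_tsum _ fun j _ => mul_nonneg (hx0 j) (inv_nonneg.2 (by linarith [hx1 j]))

/-- Point evaluations in `𝔻^∞ ∩ ℓ²` are bounded; the bound is uniform over points with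
coordinatewise dominated moduli. -/
theorem norm_eval_le (hp : 2 ≤ p) {r : ℕ → ℝ} (hr0 : ∀ j, 0 ≤ r j) (hr1 : ∀ j, r j < 1)
    (hr : Summable fun j => r j ^ 2) :
    ∃ C : ℝ, ∀ (z : ℕ → ℂ), (∀ j, ‖z j‖ ≤ r j) → ∀ P : MvPolynomial ℕ ℂ,
      ‖MvPolynomial.eval z P‖ ≤ C * ‖polyLp p 0 P‖ := by
  obtain ⟨C, hC⟩ := sum_finsuppProd_pow_le (x := fun j => r j ^ 2) (fun j => sq_nonneg _)
    (fun j => by have := hr0 j; have := hr1 j; nlinarith) hr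
  refine ⟨Real.sqrt C, fun z hz P => ?_⟩
  have hC0 : 0 ≤ C := by simpa using hC ∅
  have h1 : ‖MvPolynomial.eval z P‖ ≤
      ∑ d ∈ P.support, ‖P.coeff d‖ * d.prod (fun j k => r j ^ k) := by
    rw [MvPolynomial.eval_eq]
    refine (norm_sum_le _ _).trans (Finset.sum_le_sum fun d _ => ?_)
    rw [norm_mul, norm_prod, Finsupp.prod]
    gcongr with j hj
    rw [norm_pow]
    gcongr
    exact hz j
  have h2 : ‖MvPolynomial.eval z P‖ ^ 2 ≤ (Real.sqrt C * ‖polyLp p 0 P‖) ^ 2 := by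
    calc ‖MvPolynomial.eval z P‖ ^ 2
        ≤ (∑ d ∈ P.support, ‖P.coeff d‖ * d.prod (fun j k => r j ^ k)) ^ 2 := by gcongr
      _ ≤ (∑ d ∈ P.support, ‖P.coeff d‖ ^ 2) *
          ∑ d ∈ P.support, (d.prod (fun j k => r j ^ k)) ^ 2 :=
        Finset.sum_mul_sq_le_sq_mul_sq _ _ _
      _ ≤ ‖polyLp p 0 P‖ ^ 2 * C := by
        gcongr
        · exact sum_norm_coeff_sq_le hp P
        · refine le_trans (le_of_eq ?_) (hC P.support)
          refine Finset.sum_congr rfl fun d _ => ?_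
          simp only [Finsupp.prod, ← Finset.prod_pow, ← pow_mul, mul_comm]
      _ = (Real.sqrt C * ‖polyLp p 0 P‖) ^ 2 := by
        rw [mul_pow, Real.sq_sqrt hC0, mul_comm]
  exact le_of_sq_le_sq h2 (by positivity)

/-! ### Poisson averages along the Kronecker flow -/

theorem kroneckerFlow_add (s t : ℝ) (τ : Torus) :
    kroneckerFlow (s + t) τ = kroneckerFlow s (kroneckerFlow t τ) := by
  funext j
  simp only [kroneckerFlow, ← mul_assoc, ← Circle.exp_add]
  congr 2
  ring

theorem continuous_kroneckerFlow : Continuous fun q : ℝ × Torus => kroneckerFlow q.1 q.2 := by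
  unfold kroneckerFlow
  fun_prop

theorem measurePreserving_kroneckerFlow (t : ℝ) :
    MeasurePreserving (kroneckerFlow t) haar haar := by
  have : kroneckerFlow t = fun τ => kroneckerFlow t 1 * τ := funext (kroneckerFlow_eq_mul t)
  rw [this]
  exact measurePreserving_mul_left haar _

theorem continuous_boundaryMap (θ : ℝ) : Continuous (boundaryMap θ) :=
  continuous_pi (continuous_boundaryMap_apply θ)

theorem continuous_eval (P : MvPolynomial ℕ ℂ) :
    Continuous fun z : ℕ → ℂ => MvPolynomial.eval z P :=
  MvPolynomial.continuous_eval P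

theorem exp_neg_log_bohrIndex {y : ℝ} (d : ℕ →₀ ℕ) :
    Real.exp (-(y * |Real.log (bohrIndex d)|)) = (bohrIndex d : ℝ) ^ (-y) := by
  have h : (1 : ℝ) ≤ bohrIndex d := by exact_mod_cast bohrIndex_pos d
  rw [abs_of_nonneg (Real.log_nonneg h), Real.rpow_def_of_pos (by linarith)]
  congr 1
  ring

theorem integrable_poissonKernel_mul_exp {y : ℝ} (hy : 0 < y) (l : ℝ) :
    Integrable fun u : ℝ => (poissonKernel y u : ℂ) * Complex.exp (-(l * u : ℝ) * Complex.I) := by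
  refine (integrable_poissonKernel hy).ofReal.mul_bdd (c := 1) (by fun_prop)
    (ae_of_all _ fun u => ?_)
  rw [← Complex.ofReal_neg, Complex.norm_exp_ofReal_mul_I]

/-- Averaging along the Kronecker flow against the Poisson kernel at height `y` pushes a
polynomial from `b_σ(𝕋^∞)` to `b_{σ+y}(𝕋^∞)`. -/
theorem integral_poissonKernel_mul_eval (σ : ℝ) {y : ℝ} (hy : 0 < y) (τ : Torus)
    (P : MvPolynomial ℕ ℂ) :
    ∫ u : ℝ, (poissonKernel y u : ℂ) *
        MvPolynomial.eval (boundaryMap σ (kroneckerFlow u τ)) P =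
      MvPolynomial.eval (boundaryMap (σ + y) τ) P := by
  have hterm : ∀ u : ℝ, (poissonKernel y u : ℂ) *
      MvPolynomial.eval (boundaryMap σ (kroneckerFlow u τ)) P =
      ∑ d ∈ P.support, (P.coeff d * (((bohrIndex d : ℝ) ^ (-σ) : ℝ) : ℂ) * torusChar d τ) *
        ((poissonKernel y u : ℂ) *
          Complex.exp (-(Real.log (bohrIndex d) * u : ℝ) * Complex.I)) := by
    intro u
    rw [eval_boundaryMap, Finset.mul_sum]
    refine Finset.sum_congr rfl fun d _ => ?_
    rw [torusChar_kroneckerFlow]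
    ring
  simp_rw [hterm]
  rw [integral_finsetSum _ fun d _ => (integrable_poissonKernel_mul_exp hy _).const_mul _,
    eval_boundaryMap]
  refine Finset.sum_congr rfl fun d _ => ?_
  rw [integral_const_mul, integral_poissonKernel_mul_exp hy, exp_neg_log_bohrIndex, neg_add,
    Real.rpow_add (by exact_mod_cast bohrIndex_pos d)]
  push_cast
  ring

/-- The class in `L^p(𝕋^∞)` of a character. -/
def charLp (p : ℝ≥0∞) [Fact (1 ≤ p)] (d : ℕ →₀ ℕ) : Lp ℂ p haar :=
  ContinuousMap.toLp (E := ℂ) p haar ℂ ⟨torusChar d, continuous_torusChar d⟩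

theorem polyMap_eq_sum (θ : ℝ) (P : MvPolynomial ℕ ℂ) :
    polyMap θ P = ∑ d ∈ P.support, (P.coeff d * (((bohrIndex d : ℝ) ^ (-θ) : ℝ) : ℂ)) •
      (⟨torusChar d, continuous_torusChar d⟩ : C(Torus, ℂ)) := by
  ext τ
  rw [polyMap_apply, eval_boundaryMap, ContinuousMap.sum_apply]
  rfl

theorem polyLp_eq_sum (θ : ℝ) (P : MvPolynomial ℕ ℂ) :
    polyLp p θ P = ∑ d ∈ P.support, (P.coeff d * (((bohrIndex d : ℝ) ^ (-θ) : ℝ) : ℂ)) •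
      charLp p d := by
  change ContinuousMap.toLp (E := ℂ) p haar ℂ (polyMap θ P) = _
  rw [polyMap_eq_sum, map_sum]
  simp only [map_smul]
  rfl

/-- The sum on the left is the class of `P ∘ T_u`, and the flow preserves Haar measure. -/
theorem norm_sum_charLp_kroneckerFlow (u : ℝ) (P : MvPolynomial ℕ ℂ) :
    ‖∑ d ∈ P.support, (P.coeff d * Complex.exp (-(Real.log (bohrIndex d) * u : ℝ) * Complex.I)) •
      charLp p d‖ = ‖polyLp p 0 P‖ := by
  have hT : Continuous (kroneckerFlow u) :=
    continuous_kroneckerFlow.comp (Continuous.prodMk_right u)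
  have h1 : ∑ d ∈ P.support, (P.coeff d *
      Complex.exp (-(Real.log (bohrIndex d) * u : ℝ) * Complex.I)) • charLp p d =
      ContinuousMap.toLp (E := ℂ) p haar ℂ ((polyMap 0 P).comp ⟨kroneckerFlow u, hT⟩) := by
    have : (polyMap 0 P).comp ⟨kroneckerFlow u, hT⟩ = ∑ d ∈ P.support, (P.coeff d *
        Complex.exp (-(Real.log (bohrIndex d) * u : ℝ) * Complex.I)) •
        (⟨torusChar d, continuous_torusChar d⟩ : C(Torus, ℂ)) := by
      ext τ
      rw [ContinuousMap.comp_apply, polyMap_apply, ContinuousMap.sum_apply, ContinuousMap.coe_mk,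
        eval_boundaryMap]
      refine Finset.sum_congr rfl fun d _ => ?_
      rw [torusChar_kroneckerFlow]
      simp [mul_assoc]
    rw [this, map_sum]
    simp only [map_smul]
    rfl
  rw [h1, norm_polyLp, Lp.norm_def, eLpNorm_congr_ae (ContinuousMap.coeFn_toLp haar _)]
  congr 1
  exact eLpNorm_comp_measurePreserving (polyMap 0 P).continuous.aestronglyMeasurable
    (measurePreserving_kroneckerFlow u)

theorem integral_poissonKernel {y : ℝ} (hy : 0 < y) : ∫ u, poissonKernel y u = 1 := by
  have h := integral_poissonKernel_mul_exp hy 0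
  simp only [zero_mul, abs_zero, mul_zero, neg_zero, Complex.ofReal_zero, Complex.exp_zero,
    mul_one, Real.exp_zero, Complex.ofReal_one] at h
  rw [integral_complex_ofReal] at h
  exact_mod_cast h

/-- Restriction to `b_θ(𝕋^∞)` is a contraction for every `L^p` norm: it is an average over
the measure preserving Kronecker flow. -/
theorem norm_polyLp_le {θ : ℝ} (hθ : 0 ≤ θ) (P : MvPolynomial ℕ ℂ) :
    ‖polyLp p θ P‖ ≤ ‖polyLp p 0 P‖ := by
  rcases hθ.eq_or_lt with rfl | hθ
  · rfl
  have key : polyLp p θ P = ∫ u : ℝ, (poissonKernel θ u : ℂ) • ∑ d ∈ P.support,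
      (P.coeff d * Complex.exp (-(Real.log (bohrIndex d) * u : ℝ) * Complex.I)) •
        charLp p d := by
    have hterm : ∀ u : ℝ, (poissonKernel θ u : ℂ) • ∑ d ∈ P.support,
        (P.coeff d * Complex.exp (-(Real.log (bohrIndex d) * u : ℝ) * Complex.I)) •
        charLp p d = ∑ d ∈ P.support, ((poissonKernel θ u : ℂ) *
          Complex.exp (-(Real.log (bohrIndex d) * u : ℝ) * Complex.I)) •
          (P.coeff d • charLp p d) := by
      intro u
      rw [Finset.smul_sum]
      refine Finset.sum_congr rfl fun d _ => ?_
      rw [smul_smul, smul_smul]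
      congr 1
      ring
    simp_rw [hterm]
    rw [integral_finsetSum _ fun d _ => (integrable_poissonKernel_mul_exp hθ _).smul_const _,
      polyLp_eq_sum]
    refine Finset.sum_congr rfl fun d _ => ?_
    rw [integral_smul_const, integral_poissonKernel_mul_exp hθ, exp_neg_log_bohrIndex, smul_smul,
      mul_comm]
  rw [key]
  calc _ ≤ ∫ u : ℝ, poissonKernel θ u * ‖polyLp p 0 P‖ := by
        refine norm_integral_le_of_norm_le ((integrable_poissonKernel hθ).mul_const _)
          (ae_of_all _ fun u => ?_)
        rw [norm_smul, norm_sum_charLp_kroneckerFlow,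
          Complex.norm_of_nonneg (poissonKernel_nonneg hθ.le u)]
    _ = ‖polyLp p 0 P‖ := by rw [integral_mul_const, integral_poissonKernel hθ, one_mul]

/-! ### Embedding of Dirichlet polynomials on the critical line -/

/-- The Gram kernel `(mn)^{-1/2} min(m/n, n/m)` of the functions `n^{-1/2-iu}` in the
space `L²` of the Cauchy distribution. -/
def gramKernel (m n : ℕ) : ℝ :=
  (m : ℝ) ^ (-(1 / 2) : ℝ) * (n : ℝ) ^ (-(1 / 2) : ℝ) * Real.exp (-|Real.log m - Real.log n|)

theorem gramKernel_comm (m n : ℕ) : gramKernel m n = gramKernel n m := by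
  rw [gramKernel, gramKernel, abs_sub_comm, mul_comm ((m : ℝ) ^ _)]

theorem gramKernel_nonneg (m n : ℕ) : 0 ≤ gramKernel m n := by
  unfold gramKernel
  positivity

theorem rpow_neg_half (n : ℕ) : (n : ℝ) ^ (-(1 / 2) : ℝ) = (Real.sqrt n)⁻¹ := by
  rw [Real.rpow_neg (Nat.cast_nonneg n), Real.sqrt_eq_rpow]

theorem gramKernel_le_of_le {m n : ℕ} (hn : 0 < n) (h : n ≤ m) : gramKernel m n ≤ (m : ℝ)⁻¹ := by
  have hn' : (0 : ℝ) < n := Nat.cast_pos.2 hn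
  have hm' : (0 : ℝ) < m := Nat.cast_pos.2 (hn.trans_le h)
  have hnm : (n : ℝ) ≤ m := Nat.cast_le.2 h
  have hlog : Real.log n ≤ Real.log m := Real.log_le_log hn' hnm
  rw [gramKernel, rpow_neg_half, rpow_neg_half, abs_of_nonneg (by linarith), neg_sub, Real.exp_sub,
    Real.exp_log hn', Real.exp_log hm']
  have hx := Real.sqrt_pos.2 hm'
  have hy := Real.sqrt_pos.2 hn'
  have hxy : Real.sqrt n ≤ Real.sqrt m := Real.sqrt_le_sqrt hnm
  calc (Real.sqrt m)⁻¹ * (Real.sqrt n)⁻¹ * (n / m)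
      = (Real.sqrt m)⁻¹ * Real.sqrt n * (m : ℝ)⁻¹ := by
        conv_lhs => rw [← Real.mul_self_sqrt hn'.le]
        simp only [Real.sqrt_mul_self hy.le]
        field_simp
    _ ≤ 1 * (m : ℝ)⁻¹ := by
        gcongr
        rw [inv_mul_le_iff₀ hx]
        linarith
    _ = _ := one_mul _

theorem gramKernel_le_of_lt {m n : ℕ} (hm : 0 < m) (h : m < n) :
    gramKernel m n ≤ Real.sqrt m * (n * Real.sqrt n)⁻¹ := by
  have hm' : (0 : ℝ) < m := Nat.cast_pos.2 hm
  have hn' : (0 : ℝ) < n := Nat.cast_pos.2 (hm.trans h)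
  have hlog : Real.log m ≤ Real.log n := Real.log_le_log hm' (Nat.cast_le.2 h.le)
  rw [gramKernel, rpow_neg_half, rpow_neg_half, abs_of_nonpos (by linarith), neg_neg, Real.exp_sub,
    Real.exp_log hn', Real.exp_log hm']
  have hx := Real.sqrt_pos.2 hm'
  have hy := Real.sqrt_pos.2 hn'
  refine le_of_eq ?_
  have := Real.mul_self_sqrt hm'.le
  field_simp
  nlinarith

theorem sum_Ioc_inv_mul_sqrt_le {m M : ℕ} (hm : 0 < m) (h : m ≤ M) :
    ∑ n ∈ Finset.Ioc m M, ((n : ℝ) * Real.sqrt n)⁻¹ ≤ 2 / Real.sqrt m - 2 / Real.sqrt M := by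
  induction M, h using Nat.le_induction with
  | base => simp
  | succ M h ih =>
    rw [Finset.sum_Ioc_succ_top (by omega)]
    have hM : (0 : ℝ) < M := Nat.cast_pos.2 (hm.trans_le h)
    have hx := Real.sqrt_pos.2 hM
    have hM1 : (0 : ℝ) < (M + 1 : ℕ) := by positivity
    have hy := Real.sqrt_pos.2 hM1
    have hxy : Real.sqrt M ≤ Real.sqrt (M + 1 : ℕ) :=
      Real.sqrt_le_sqrt (by push_cast; linarith)
    have hsq1 := Real.mul_self_sqrt hM.le
    have hsq2 := Real.mul_self_sqrt hM1.le
    have hsq3 : (((M + 1 : ℕ) : ℝ)) = M + 1 := by push_cast; ring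
    set x := Real.sqrt M
    set y := Real.sqrt (M + 1 : ℕ)
    have key : (((M + 1 : ℕ) : ℝ) * y)⁻¹ ≤ 2 / x - 2 / y := by
      rw [← hsq2, div_sub_div _ _ hx.ne' hy.ne', inv_eq_one_div, div_le_div_iff₀ (by positivity)
        (by positivity)]
      have h1 : (y - x) * (y + x) = 1 := by nlinarith
      have h2 : 1 ≤ 2 * y * (y - x) := by nlinarith
      have h3 : x * y ≤ y * y := by nlinarith
      nlinarith [mul_pos hx hy, mul_pos hy hy, mul_le_mul_of_nonneg_left h2 (mul_pos hy hy).le]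
    linarith

/-- The rows of the Gram kernel are uniformly summable. -/
theorem sum_gramKernel_le {m : ℕ} (hm : 0 < m) (T : Finset ℕ) (hT : ∀ n ∈ T, 0 < n) :
    ∑ n ∈ T, gramKernel m n ≤ 3 := by
  have hm' : (0 : ℝ) < m := Nat.cast_pos.2 hm
  set M := max m (T.sup id) with hM
  have hsub : T ⊆ Finset.Ioc 0 m ∪ Finset.Ioc m M := by
    intro n hn
    rw [Finset.mem_union, Finset.mem_Ioc, Finset.mem_Ioc]
    have h1 : n ≤ M := (Finset.le_sup (f := id) hn).trans (le_max_right _ _)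
    have h2 := hT n hn
    omega
  have hdisj : Disjoint (Finset.Ioc 0 m) (Finset.Ioc m M) := by
    rw [Finset.disjoint_left]
    intro n h1 h2
    rw [Finset.mem_Ioc] at h1 h2
    omega
  calc ∑ n ∈ T, gramKernel m n
      ≤ ∑ n ∈ Finset.Ioc 0 m ∪ Finset.Ioc m M, gramKernel m n :=
        Finset.sum_le_sum_of_subset_of_nonneg hsub fun n _ _ => gramKernel_nonneg m n
    _ = ∑ n ∈ Finset.Ioc 0 m, gramKernel m n + ∑ n ∈ Finset.Ioc m M, gramKernel m n :=
        Finset.sum_union hdisj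
    _ ≤ ∑ n ∈ Finset.Ioc 0 m, (m : ℝ)⁻¹ +
        ∑ n ∈ Finset.Ioc m M, Real.sqrt m * (n * Real.sqrt n)⁻¹ := by
        gcongr with n hn n hn
        · exact gramKernel_le_of_le (Finset.mem_Ioc.1 hn).1 (Finset.mem_Ioc.1 hn).2
        · exact gramKernel_le_of_lt hm (Finset.mem_Ioc.1 hn).1
    _ ≤ 1 + Real.sqrt m * (2 / Real.sqrt m - 2 / Real.sqrt M) := by
        rw [← Finset.mul_sum]
        gcongr
        · simp [hm'.ne']
        · exact sum_Ioc_inv_mul_sqrt_le hm (le_max_left _ _)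
    _ ≤ 1 + Real.sqrt m * (2 / Real.sqrt m) := by
        gcongr
        simp only [sub_le_self_iff]
        positivity
    _ = 3 := by
        have := (Real.sqrt_pos.2 hm').ne'
        field_simp
        norm_num

/-- Local embedding of Dirichlet polynomials on the critical line: in the weight of the
Poisson kernel at height `1`, the `L²` norm of `u ↦ P(b_{1/2}(T_u τ))` is controlled, uniformly
in `τ`, by the coefficients. This is Schur's test for the Gram kernel. -/
theorem integral_poissonKernel_mul_norm_sq_le (τ : Torus) (P : MvPolynomial ℕ ℂ) :
    ∫ u : ℝ, poissonKernel 1 u *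
        ‖MvPolynomial.eval (boundaryMap (1 / 2) (kroneckerFlow u τ)) P‖ ^ 2 ≤
      3 * ∑ d ∈ P.support, ‖P.coeff d‖ ^ 2 := by
  set n : (ℕ →₀ ℕ) → ℕ := bohrIndex with hn
  set a : (ℕ →₀ ℕ) → ℂ := fun d =>
    P.coeff d * (((n d : ℝ) ^ (-(1 / 2) : ℝ) : ℝ) : ℂ) * torusChar d τ with ha
  have hnorm : ∀ d, ‖a d‖ = ‖P.coeff d‖ * (n d : ℝ) ^ (-(1 / 2) : ℝ) := by
    intro d
    rw [ha]
    simp only [norm_mul, norm_torusChar, mul_one]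
    rw [Complex.norm_of_nonneg (by positivity)]
  have hexp : ∀ u : ℝ, ((poissonKernel 1 u *
      ‖MvPolynomial.eval (boundaryMap (1 / 2) (kroneckerFlow u τ)) P‖ ^ 2 : ℝ) : ℂ) =
      ∑ d ∈ P.support, ∑ e ∈ P.support, (a d * starRingEnd ℂ (a e)) *
        ((poissonKernel 1 u : ℂ) *
          Complex.exp (-((Real.log (n d) - Real.log (n e)) * u : ℝ) * Complex.I)) := by
    intro u
    rw [Complex.ofReal_mul, ← Complex.normSq_eq_norm_sq, ← Complex.mul_conj, eval_boundaryMap,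
      map_sum, Finset.sum_mul_sum, Finset.mul_sum]
    refine Finset.sum_congr rfl fun d _ => ?_
    rw [Finset.mul_sum]
    refine Finset.sum_congr rfl fun e _ => ?_
    have hE : Complex.exp (-((Real.log (n d) - Real.log (n e)) * u : ℝ) * Complex.I) =
        Complex.exp (-(Real.log (n d) * u : ℝ) * Complex.I) *
          starRingEnd ℂ (Complex.exp (-(Real.log (n e) * u : ℝ) * Complex.I)) := by
      rw [← Complex.exp_conj, ← Complex.exp_add]
      congr 1
      simp only [map_mul, map_neg, Complex.conj_ofReal, Complex.conj_I]
      push_cast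
      ring
    rw [hE, torusChar_kroneckerFlow, torusChar_kroneckerFlow]
    simp only [ha, map_mul]
    ring
  have hint := fun d e : ℕ →₀ ℕ => (integrable_poissonKernel_mul_exp one_pos
    (Real.log (n d) - Real.log (n e))).const_mul (a d * starRingEnd ℂ (a e))
  have heq : ((∫ u : ℝ, poissonKernel 1 u *
        ‖MvPolynomial.eval (boundaryMap (1 / 2) (kroneckerFlow u τ)) P‖ ^ 2 : ℝ) : ℂ) =
      ∑ d ∈ P.support, ∑ e ∈ P.support, (a d * starRingEnd ℂ (a e)) *
        (Real.exp (-(1 * |Real.log (n d) - Real.log (n e)|)) : ℂ) := by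
    rw [← integral_complex_ofReal]
    simp_rw [hexp]
    rw [integral_finsetSum _ fun d _ => integrable_finsetSum _ fun e _ => hint d e]
    simp_rw [integral_finsetSum P.support fun e _ => hint _ e, integral_const_mul,
      integral_poissonKernel_mul_exp one_pos]
  have hrow : ∀ d, ∑ e ∈ P.support, gramKernel (n d) (n e) ≤ 3 := by
    intro d
    rw [← Finset.sum_image (g := n) (f := gramKernel (n d)) bohrIndex_injective.injOn]
    refine sum_gramKernel_le (bohrIndex_pos d) _ fun k hk => ?_
    obtain ⟨e, -, rfl⟩ := Finset.mem_image.1 hk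
    exact bohrIndex_pos e
  calc ∫ u : ℝ, poissonKernel 1 u *
        ‖MvPolynomial.eval (boundaryMap (1 / 2) (kroneckerFlow u τ)) P‖ ^ 2
      ≤ ‖((∫ u : ℝ, poissonKernel 1 u *
        ‖MvPolynomial.eval (boundaryMap (1 / 2) (kroneckerFlow u τ)) P‖ ^ 2 : ℝ) : ℂ)‖ := by
        rw [Complex.norm_real]
        exact le_abs_self _
    _ ≤ ∑ d ∈ P.support, ∑ e ∈ P.support,
        ‖P.coeff d‖ * ‖P.coeff e‖ * gramKernel (n d) (n e) := by
        rw [heq]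
        refine (norm_sum_le _ _).trans (Finset.sum_le_sum fun d _ =>
          (norm_sum_le _ _).trans (Finset.sum_le_sum fun e _ => le_of_eq ?_))
        rw [norm_mul, norm_mul, RCLike.norm_conj, hnorm, hnorm,
          Complex.norm_of_nonneg (Real.exp_pos _).le, one_mul, gramKernel]
        ring
    _ ≤ ∑ d ∈ P.support, ∑ e ∈ P.support,
        (‖P.coeff d‖ ^ 2 / 2 * gramKernel (n d) (n e) +
          ‖P.coeff e‖ ^ 2 / 2 * gramKernel (n e) (n d)) := by
        refine Finset.sum_le_sum fun d _ => Finset.sum_le_sum fun e _ => ?_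
        rw [gramKernel_comm (n e), ← add_mul]
        refine mul_le_mul_of_nonneg_right ?_ (gramKernel_nonneg _ _)
        nlinarith [sq_nonneg (‖P.coeff d‖ - ‖P.coeff e‖)]
    _ = ∑ d ∈ P.support, ‖P.coeff d‖ ^ 2 * ∑ e ∈ P.support, gramKernel (n d) (n e) := by
        simp_rw [Finset.sum_add_distrib]
        rw [Finset.sum_comm (f := fun d e => ‖P.coeff e‖ ^ 2 / 2 * gramKernel (n e) (n d)),
          ← Finset.sum_add_distrib]
        refine Finset.sum_congr rfl fun d _ => ?_
        rw [← Finset.mul_sum]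
        ring
    _ ≤ ∑ d ∈ P.support, ‖P.coeff d‖ ^ 2 * 3 := by
        gcongr with d hd
        exact hrow d
    _ = _ := by rw [← Finset.sum_mul, mul_comm]

/-! ### Poisson integrals at Lebesgue points -/

theorem one_add_sq_le {t u ρ q : ℝ} (hρ : 0 < ρ) (h1 : ρ ^ 2 ≤ q) (h2 : (u - t) ^ 2 ≤ q) :
    1 + u ^ 2 ≤ ((1 + 2 * t ^ 2) / ρ ^ 2 + 2) * q := by
  have h3 : (1 + 2 * t ^ 2) ≤ (1 + 2 * t ^ 2) / ρ ^ 2 * q := by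
    rw [div_mul_eq_mul_div, le_div_iff₀ (by positivity)]
    gcongr
  nlinarith [sq_nonneg (u - 2 * t)]

theorem poissonKernel_sub_le_of_le {t u y ρ : ℝ} (hy : 0 < y) (hρ : 0 < ρ)
    (h : ρ ^ 2 ≤ y ^ 2 + (u - t) ^ 2) :
    poissonKernel y (u - t) ≤ y * ((1 + 2 * t ^ 2) / ρ ^ 2 + 2) * poissonKernel 1 u := by
  have h1 := one_add_sq_le (t := t) (u := u) hρ h (by nlinarith)
  have hq : 0 < y ^ 2 + (u - t) ^ 2 := by positivity
  have : y / (y ^ 2 + (u - t) ^ 2) ≤ y * ((1 + 2 * t ^ 2) / ρ ^ 2 + 2) * (1 / (1 ^ 2 + u ^ 2)) := by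
    rw [mul_one_div, div_le_div_iff₀ hq (by positivity), mul_assoc]
    gcongr
    simpa using h1
  unfold poissonKernel
  calc _ ≤ Real.pi⁻¹ * (y * ((1 + 2 * t ^ 2) / ρ ^ 2 + 2) * (1 / (1 ^ 2 + u ^ 2))) := by gcongr
    _ = _ := by ring

/-- Away from its centre the Poisson kernel is `O(y)` relative to the kernel at height `1`. -/
theorem poissonKernel_sub_le_of_dist {t u y ρ : ℝ} (hy : 0 < y) (hρ : 0 < ρ) (h : ρ ≤ |u - t|) :
    poissonKernel y (u - t) ≤ y * ((1 + 2 * t ^ 2) / ρ ^ 2 + 2) * poissonKernel 1 u := by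
  refine poissonKernel_sub_le_of_le hy hρ ?_
  have : ρ ^ 2 ≤ (u - t) ^ 2 := by
    rw [← sq_abs (u - t)]
    gcongr
  nlinarith

theorem poissonKernel_sub_le {y : ℝ} (hy : 0 < y) (t u : ℝ) :
    poissonKernel y (u - t) ≤ y * ((1 + 2 * t ^ 2) / y ^ 2 + 2) * poissonKernel 1 u :=
  poissonKernel_sub_le_of_le hy hy (by nlinarith [sq_nonneg (u - t)])

/-- On some dyadic interval `[-2^k y, 2^k y]` containing `v`, the Poisson kernel at `v` is at most
`4 · 4^{-k} / y`; hence the kernel is dominated by a summable series of multiples of indicators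
of these intervals. -/
theorem exists_poissonKernel_le_dyadic {y : ℝ} (hy : 0 < y) (v : ℝ) :
    ∃ k : ℕ, |v| ≤ 2 ^ k * y ∧ poissonKernel y v ≤ 4 * (1 / 4) ^ k / y := by
  have hex : ∃ k : ℕ, |v| ≤ 2 ^ k * y := by
    obtain ⟨k, hk⟩ := pow_unbounded_of_one_lt (|v| / y) (one_lt_two)
    exact ⟨k, by rw [div_lt_iff₀ hy] at hk; exact hk.le⟩
  classical
  refine ⟨Nat.find hex, Nat.find_spec hex, ?_⟩
  have hpi : Real.pi⁻¹ ≤ 1 := inv_le_one_of_one_le₀ (by linarith [Real.pi_gt_three])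
  have hk : poissonKernel y v ≤ y / (y ^ 2 + v ^ 2) := by
    unfold poissonKernel
    exact mul_le_of_le_one_left (by positivity) hpi
  refine hk.trans ?_
  rcases h : Nat.find hex with _ | k
  · rw [div_le_div_iff₀ (by positivity) hy]
    nlinarith [sq_nonneg v, sq_nonneg y]
  · have hlt : 2 ^ k * y < |v| := by
      have := Nat.find_min hex (m := k) (by omega)
      exact not_le.1 this
    have hsq : (4 : ℝ) ^ k * y ^ 2 ≤ v ^ 2 := by
      rw [← sq_abs v]
      calc (4 : ℝ) ^ k * y ^ 2 = (2 ^ k * y) ^ 2 := by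
            rw [mul_pow, ← pow_mul, mul_comm k, pow_mul]; norm_num
        _ ≤ |v| ^ 2 := by gcongr
    rw [pow_succ (1 / 4 : ℝ), one_div_pow, div_le_div_iff₀ (by positivity) hy]
    have h4 : (0 : ℝ) < 4 ^ k := by positivity
    calc y * y = 4 * (1 / 4 ^ k * (1 / 4)) * (4 ^ k * y ^ 2) := by field_simp
      _ ≤ 4 * (1 / 4 ^ k * (1 / 4)) * (y ^ 2 + v ^ 2) := by
        gcongr
        nlinarith [sq_nonneg y]

/-- If the mass of `h` on intervals centred at `t` of radius `r ≤ δ` is at most `ε r`, the part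
of the Poisson average of `h` near `t` is at most `8 ε`. -/
theorem lintegral_poissonKernel_closedBall_le {h : ℝ → ℝ≥0∞} (hh : AEMeasurable h)
    {t δ ε y : ℝ} (hy : 0 < y) (hδ : 0 < δ) (hε : 0 ≤ ε)
    (hmass : ∀ r, 0 < r → r ≤ δ → ∫⁻ u in Metric.closedBall t r, h u ≤ ENNReal.ofReal (ε * r)) :
    ∫⁻ u in Metric.closedBall t δ, ENNReal.ofReal (poissonKernel y (u - t)) * h u ≤
      ENNReal.ofReal (8 * ε) := by
  set c : ℕ → ℝ := fun k => 4 * (1 / 4) ^ k / y with hc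
  have hc0 : ∀ k, 0 ≤ c k := fun k => by rw [hc]; positivity
  calc ∫⁻ u in Metric.closedBall t δ, ENNReal.ofReal (poissonKernel y (u - t)) * h u
      ≤ ∫⁻ u in Metric.closedBall t δ, ∑' k : ℕ, ENNReal.ofReal (c k) *
          (Metric.closedBall t (2 ^ k * y)).indicator h u := by
        refine lintegral_mono fun u => ?_
        obtain ⟨k, hk1, hk2⟩ := exists_poissonKernel_le_dyadic hy (u - t)
        refine le_trans ?_ (ENNReal.le_tsum k)
        rw [Set.indicator_of_mem (by rwa [Metric.mem_closedBall, Real.dist_eq])]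
        gcongr
    _ = ∑' k : ℕ, ENNReal.ofReal (c k) * ∫⁻ u in Metric.closedBall t δ,
          (Metric.closedBall t (2 ^ k * y)).indicator h u := by
        rw [lintegral_tsum fun k =>
          ((hh.restrict.indicator measurableSet_closedBall).const_mul _)]
        congr 1
        ext k
        rw [lintegral_const_mul' _ _ ENNReal.ofReal_ne_top]
    _ ≤ ∑' k : ℕ, ENNReal.ofReal (4 * ε * (1 / 2) ^ k) := by
        refine ENNReal.tsum_le_tsum fun k => ?_
        have hr : 0 < min (2 ^ k * y) δ := lt_min (by positivity) hδ
        have h1 : ∫⁻ u in Metric.closedBall t δ, (Metric.closedBall t (2 ^ k * y)).indicator h u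
            ≤ ENNReal.ofReal (ε * min (2 ^ k * y) δ) := by
          rw [lintegral_indicator measurableSet_closedBall,
            Measure.restrict_restrict measurableSet_closedBall]
          refine le_trans (lintegral_mono_set ?_) (hmass _ hr (min_le_right _ _))
          intro u hu
          exact Metric.mem_closedBall.2 (le_min hu.1 hu.2)
        refine (mul_le_mul_right h1 _).trans ?_
        rw [← ENNReal.ofReal_mul (hc0 k)]
        apply ENNReal.ofReal_le_ofReal
        calc c k * (ε * min (2 ^ k * y) δ) ≤ c k * (ε * (2 ^ k * y)) :=
              mul_le_mul_of_nonneg_left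
                (mul_le_mul_of_nonneg_left (min_le_left _ _) hε) (hc0 k)
          _ = 4 * ε * (1 / 2) ^ k := by
              have : ((1 : ℝ) / 4) ^ k * 2 ^ k = (1 / 2) ^ k := by
                rw [← mul_pow]; norm_num
              rw [hc, ← this]
              field_simp
    _ ≤ ENNReal.ofReal (8 * ε) := by
        rw [← ENNReal.ofReal_tsum_of_nonneg (fun k => by positivity)
          (summable_geometric_two.mul_left _), tsum_mul_left, tsum_geometric_two]
        apply le_of_eq
        congr 1
        ring

theorem integrable_poissonKernel_sub_mul {g : ℝ → ℂ}
    (hg : Integrable fun u => (poissonKernel 1 u : ℂ) * g u) {y : ℝ} (hy : 0 < y) (t : ℝ) :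
    Integrable fun u => (poissonKernel y (u - t) : ℂ) * g u := by
  have h1 := continuous_poissonKernel one_pos
  have h2 := continuous_poissonKernel hy
  have hne : ∀ u, (poissonKernel 1 u : ℂ) ≠ 0 := fun u =>
    Complex.ofReal_ne_zero.2 (poissonKernel_pos one_pos u).ne'
  have heq : (fun u => (poissonKernel y (u - t) : ℂ) * g u) = fun u =>
      ((poissonKernel y (u - t) : ℂ) / (poissonKernel 1 u : ℂ)) *
        ((poissonKernel 1 u : ℂ) * g u) := by
    ext u
    have := hne u
    field_simp
  rw [heq]
  refine hg.bdd_mul (c := y * ((1 + 2 * t ^ 2) / y ^ 2 + 2)) ?_ (ae_of_all _ fun u => ?_)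
  · exact (Continuous.div (by fun_prop) (by fun_prop) hne).aestronglyMeasurable
  · rw [norm_div, Complex.norm_of_nonneg (poissonKernel_nonneg hy.le _),
      Complex.norm_of_nonneg (poissonKernel_nonneg zero_le_one _),
      div_le_iff₀ (poissonKernel_pos one_pos u)]
    exact poissonKernel_sub_le hy t u

theorem locallyIntegrable_of_poissonKernel_mul {g : ℝ → ℂ}
    (hg : Integrable fun u => (poissonKernel 1 u : ℂ) * g u) : LocallyIntegrable g := by
  have hne : ∀ u, (poissonKernel 1 u : ℂ) ≠ 0 := fun u =>
    Complex.ofReal_ne_zero.2 (poissonKernel_pos one_pos u).ne'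
  have h1 := continuous_poissonKernel one_pos
  have hc : Continuous fun u => (poissonKernel 1 u : ℂ)⁻¹ :=
    Continuous.inv₀ (by fun_prop) hne
  have heq : g = fun u => (poissonKernel 1 u : ℂ)⁻¹ • ((poissonKernel 1 u : ℂ) * g u) := by
    ext u
    rw [smul_eq_mul, inv_mul_cancel_left₀ (hne u)]
  rw [heq, ← locallyIntegrableOn_univ]
  exact (locallyIntegrableOn_univ.2 hg.locallyIntegrable).continuousOn_smul
    isOpen_univ.isLocallyClosed hc.continuousOn

/-- Fatou's theorem for Poisson integrals in the half-plane: they converge to the boundary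
function along vertical lines at every Lebesgue point, hence almost everywhere. -/
theorem ae_tendsto_integral_poissonKernel {g : ℝ → ℂ}
    (hg : Integrable fun u => (poissonKernel 1 u : ℂ) * g u) :
    ∀ᵐ t : ℝ, Tendsto (fun y : ℝ => ∫ u, (poissonKernel y (u - t) : ℂ) * g u) (𝓝[>] 0)
      (𝓝 (g t)) := by
  have hloc := locallyIntegrable_of_poissonKernel_mul hg
  filter_upwards [IsUnifLocDoublingMeasure.ae_tendsto_average_norm_sub volume hloc 1] with t ht
  have ht' : Tendsto (fun r : ℝ => ⨍ u in Metric.closedBall t r, ‖g u - g t‖) (𝓝[>] 0) (𝓝 0) := by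
    refine ht (fun _ => t) id tendsto_id ?_
    filter_upwards [self_mem_nhdsWithin] with r hr
    exact Metric.mem_closedBall_self (by simpa using (le_of_lt hr))
  have hmeas : AEStronglyMeasurable g volume := hloc.aestronglyMeasurable
  -- the weighted mass of `g - g t` is finite, which controls the tails
  have hgt : Integrable fun u => (poissonKernel 1 u : ℂ) * (g u - g t) := by
    simp_rw [mul_sub]
    exact hg.sub ((integrable_poissonKernel one_pos).ofReal.mul_const _)
  set M : ℝ≥0∞ := ∫⁻ u, ENNReal.ofReal (poissonKernel 1 u) * ‖g u - g t‖ₑ with hM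
  have hMfin : M ≠ ∞ := by
    have := hgt.2
    rw [hasFiniteIntegral_iff_enorm] at this
    refine ne_of_lt (lt_of_eq_of_lt ?_ this)
    refine lintegral_congr fun u => ?_
    rw [enorm_mul, ← ofReal_norm (poissonKernel 1 u : ℂ),
      Complex.norm_of_nonneg (poissonKernel_nonneg zero_le_one _)]
  rw [Metric.tendsto_nhds]
  intro ε hε
  -- choose a radius below which the oscillation averages are small
  have hev : ∀ᶠ r in 𝓝[>] (0 : ℝ), ⨍ u in Metric.closedBall t r, ‖g u - g t‖ < ε / 64 :=
    ht'.eventually (gt_mem_nhds (by positivity))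
  obtain ⟨δ, hδ, hδr⟩ := mem_nhdsGT_iff_exists_Ioc_subset.1 hev
  have hδ0 : 0 < δ := hδ
  have hmass : ∀ r, 0 < r → r ≤ δ →
      ∫⁻ u in Metric.closedBall t r, ‖g u - g t‖ₑ ≤ ENNReal.ofReal (ε / 32 * r) := by
    intro r hr hrδ
    have h1 : ⨍ u in Metric.closedBall t r, ‖g u - g t‖ < ε / 64 := hδr ⟨hr, hrδ⟩
    have hI : IntegrableOn (fun u => g u - g t) (Metric.closedBall t r) :=
      (hloc.integrableOn_isCompact (isCompact_closedBall t r)).sub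
        (integrableOn_const measure_closedBall_lt_top.ne)
    rw [← ofReal_integral_norm_eq_lintegral_enorm hI]
    apply ENNReal.ofReal_le_ofReal
    rw [setAverage_eq, measureReal_def, Real.volume_closedBall,
      ENNReal.toReal_ofReal (by positivity), smul_eq_mul,
      inv_mul_lt_iff₀ (by positivity)] at h1
    linarith
  set A : ℝ := (1 + 2 * t ^ 2) / δ ^ 2 + 2 with hA
  have hA0 : 0 < A := by positivity
  have hsmall : ∀ᶠ y in 𝓝[>] (0 : ℝ), y * A * M.toReal < ε / 2 := by
    have : Tendsto (fun y : ℝ => y * A * M.toReal) (𝓝[>] 0) (𝓝 (0 * A * M.toReal)) :=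
      ((tendsto_id.mul_const A).mul_const _).mono_left nhdsWithin_le_nhds
    exact this.eventually (gt_mem_nhds (by simpa using half_pos hε))
  filter_upwards [hsmall, self_mem_nhdsWithin] with y hysmall hy
  have hy : 0 < y := hy
  have hk1 : ∫ u, (poissonKernel y (u - t) : ℂ) = 1 := by
    rw [integral_complex_ofReal, integral_sub_right_eq_self (poissonKernel y) t,
      integral_poissonKernel hy, Complex.ofReal_one]
  have hdiff : (∫ u, (poissonKernel y (u - t) : ℂ) * g u) - g t =
      ∫ u, (poissonKernel y (u - t) : ℂ) * (g u - g t) := by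
    have hki : Integrable fun u => (poissonKernel y (u - t) : ℂ) * g t :=
      ((integrable_poissonKernel hy).comp_sub_right t).ofReal.mul_const _
    simp_rw [mul_sub]
    rw [integral_sub (integrable_poissonKernel_sub_mul hg hy t) hki, integral_mul_const, hk1,
      one_mul]
  have hbound : ‖∫ u, (poissonKernel y (u - t) : ℂ) * (g u - g t)‖ₑ ≤
      ENNReal.ofReal (ε / 4 + y * A * M.toReal) := by
    calc ‖∫ u, (poissonKernel y (u - t) : ℂ) * (g u - g t)‖ₑ
        ≤ ∫⁻ u, ENNReal.ofReal (poissonKernel y (u - t)) * ‖g u - g t‖ₑ := by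
          refine (enorm_integral_le_lintegral_enorm _).trans (le_of_eq ?_)
          refine lintegral_congr fun u => ?_
          rw [enorm_mul, ← ofReal_norm (poissonKernel y (u - t) : ℂ),
            Complex.norm_of_nonneg (poissonKernel_nonneg hy.le _)]
      _ = (∫⁻ u in Metric.closedBall t δ,
            ENNReal.ofReal (poissonKernel y (u - t)) * ‖g u - g t‖ₑ) +
          ∫⁻ u in (Metric.closedBall t δ)ᶜ,
            ENNReal.ofReal (poissonKernel y (u - t)) * ‖g u - g t‖ₑ :=
          (lintegral_add_compl _ measurableSet_closedBall).symm
      _ ≤ ENNReal.ofReal (8 * (ε / 32)) + ENNReal.ofReal (y * A) * M := by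
          gcongr
          · exact lintegral_poissonKernel_closedBall_le
              (hmeas.sub aestronglyMeasurable_const).enorm hy hδ0 (by positivity) hmass
          · rw [hM, ← lintegral_const_mul' _ _ ENNReal.ofReal_ne_top]
            refine le_trans (setLIntegral_mono' measurableSet_closedBall.compl fun u hu => ?_)
              (setLIntegral_le_lintegral _ _)
            rw [← mul_assoc, ← ENNReal.ofReal_mul (by positivity)]
            gcongr
            refine poissonKernel_sub_le_of_dist hy hδ0 ?_
            rw [Set.mem_compl_iff, Metric.mem_closedBall, Real.dist_eq, not_le] at hu
            exact hu.le
      _ = ENNReal.ofReal (ε / 4 + y * A * M.toReal) := by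
          rw [ENNReal.ofReal_add (by positivity) (by positivity),
            ENNReal.ofReal_mul (by positivity : 0 ≤ y * A), ENNReal.ofReal_toReal hMfin]
          congr 2
          ring
  rw [dist_eq_norm, hdiff]
  rw [← ofReal_norm, ENNReal.ofReal_le_ofReal_iff (by positivity)] at hbound
  linarith

/-! ### Values and restrictions of functions in the Hardy space -/

theorem tendsto_value (hp : 2 ≤ p) {F : Lp ℂ p haar} (hF : F ∈ hardySpace p) {z : ℕ → ℂ}
    (hz1 : ∀ j, ‖z j‖ < 1) (hz : Summable fun j => ‖z j‖ ^ 2) :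
    Tendsto (fun P => MvPolynomial.eval z P) (approx F) (𝓝 (value F z)) := by
  obtain ⟨C, hC⟩ := norm_eval_le hp (fun j => norm_nonneg (z j)) hz1 hz
  exact tendsto_limUnder_approx hF
    (MvPolynomial.aeval z : MvPolynomial ℕ ℂ →ₐ[ℂ] ℂ).toLinearMap C (hC z fun _ => le_rfl)

theorem tendsto_restriction {θ : ℝ} (hθ : 0 ≤ θ) {F : Lp ℂ p haar} (hF : F ∈ hardySpace p) :
    Tendsto (fun P => polyLp p θ P) (approx F) (𝓝 (restriction θ F)) :=
  tendsto_limUnder_approx hF (polyLp p θ) 1 fun P => by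
    rw [one_mul]
    exact norm_polyLp_le hθ P

theorem tendsto_polyLp_approx (F : Lp ℂ p haar) :
    Tendsto (fun P => polyLp p 0 P) (approx F) (𝓝 F) :=
  tendsto_comap

/-- A bound for polynomials passes to the error of approximating the extended functional. -/
theorem norm_sub_le_of_tendsto {E : Type*} [NormedAddCommGroup E] [NormedSpace ℂ E]
    {F : Lp ℂ p haar} (hF : F ∈ hardySpace p) (L : MvPolynomial ℕ ℂ →ₗ[ℂ] E) {C : ℝ}
    (hL : ∀ P, ‖L P‖ ≤ C * ‖polyLp p 0 P‖) {l : E} (hl : Tendsto L (approx F) (𝓝 l))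
    (P : MvPolynomial ℕ ℂ) : ‖L P - l‖ ≤ C * ‖polyLp p 0 P - F‖ := by
  have hne : (approx F).NeBot := (approx_neBot_iff F).2 hF
  refine le_of_tendsto_of_tendsto ((tendsto_const_nhds.sub hl).norm)
    ((tendsto_const_nhds.sub (tendsto_polyLp_approx F)).norm.const_mul C)
    (Eventually.of_forall fun Q => ?_)
  have := hL (P - Q)
  rwa [map_sub, map_sub] at this

/-- The modulus `p_j^{-θ}` of the coordinates of the points of `b_θ(𝕋^∞)`. -/
def boundaryRadius (θ : ℝ) (j : ℕ) : ℝ := (primeSeq j : ℝ) ^ (-θ)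

theorem one_lt_primeSeq (j : ℕ) : (1 : ℝ) < primeSeq j := by
  exact_mod_cast (primeSeq_prime j).one_lt

theorem boundaryRadius_nonneg (θ : ℝ) (j : ℕ) : 0 ≤ boundaryRadius θ j :=
  Real.rpow_nonneg (Nat.cast_nonneg _) _

theorem boundaryRadius_lt_one {θ : ℝ} (hθ : 0 < θ) (j : ℕ) : boundaryRadius θ j < 1 :=
  Real.rpow_lt_one_of_one_lt_of_neg (one_lt_primeSeq j) (by linarith)

theorem boundaryRadius_antitone {θ θ' : ℝ} (h : θ ≤ θ') (j : ℕ) :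
    boundaryRadius θ' j ≤ boundaryRadius θ j :=
  Real.rpow_le_rpow_of_exponent_le (one_lt_primeSeq j).le (by linarith)

theorem summable_boundaryRadius_sq {θ : ℝ} (hθ : 1 / 2 < θ) :
    Summable fun j => boundaryRadius θ j ^ 2 := by
  have h1 : Summable fun n : ℕ => (n : ℝ) ^ (-(2 * θ)) :=
    Real.summable_nat_rpow.2 (by linarith)
  refine (h1.comp_injective primeSeq_injective).congr fun j => ?_
  rw [boundaryRadius, ← Real.rpow_natCast, ← Real.rpow_mul (Nat.cast_nonneg _), Function.comp_apply]
  congr 1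
  push_cast
  ring

theorem norm_boundaryMap (θ : ℝ) (τ : Torus) (j : ℕ) :
    ‖boundaryMap θ τ j‖ = boundaryRadius θ j := by
  rw [boundaryMap, norm_mul, Circle.norm_coe, mul_one]
  exact Complex.norm_of_nonneg (boundaryRadius_nonneg θ j)

theorem tendsto_value_boundaryMap (hp : 2 ≤ p) {F : Lp ℂ p haar} (hF : F ∈ hardySpace p) {θ : ℝ}
    (hθ : 1 / 2 < θ) (τ : Torus) :
    Tendsto (fun P => MvPolynomial.eval (boundaryMap θ τ) P) (approx F)
      (𝓝 (value F (boundaryMap θ τ))) := by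
  refine tendsto_value hp hF (fun j => ?_) ?_
  · rw [norm_boundaryMap]
    exact boundaryRadius_lt_one (by linarith) j
  · simp_rw [norm_boundaryMap]
    exact summable_boundaryRadius_sq hθ

/-- Polynomials approximating `F` converge uniformly on `⋃_{θ' ≥ θ} b_{θ'}(𝕋^∞)`. -/
theorem exists_norm_eval_sub_value_le (hp : 2 ≤ p) {F : Lp ℂ p haar} (hF : F ∈ hardySpace p)
    {θ : ℝ} (hθ : 1 / 2 < θ) :
    ∃ C : ℝ, ∀ θ', θ ≤ θ' → ∀ (τ : Torus) (P : MvPolynomial ℕ ℂ),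
      ‖MvPolynomial.eval (boundaryMap θ' τ) P - value F (boundaryMap θ' τ)‖ ≤
        C * ‖polyLp p 0 P - F‖ := by
  obtain ⟨C, hC⟩ := norm_eval_le hp (boundaryRadius_nonneg θ)
    (boundaryRadius_lt_one (by linarith)) (summable_boundaryRadius_sq hθ)
  refine ⟨C, fun θ' hθ' τ P => ?_⟩
  refine norm_sub_le_of_tendsto hF
    (MvPolynomial.aeval (boundaryMap θ' τ) : MvPolynomial ℕ ℂ →ₐ[ℂ] ℂ).toLinearMap
    (hC _ fun j => ?_) (tendsto_value_boundaryMap hp hF (hθ.trans_le hθ') τ) P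
  rw [norm_boundaryMap]
  exact boundaryRadius_antitone hθ' j

theorem continuousOn_value_boundaryMap (hp : 2 ≤ p) {F : Lp ℂ p haar} (hF : F ∈ hardySpace p)
    {θ : ℝ} (hθ : 1 / 2 < θ) :
    ContinuousOn (fun q : ℝ × Torus => value F (boundaryMap q.1 q.2))
      (Set.Ici θ ×ˢ Set.univ) := by
  have hne : (approx F).NeBot := (approx_neBot_iff F).2 hF
  obtain ⟨C, hC⟩ := exists_norm_eval_sub_value_le hp hF hθ
  have hunif : TendstoUniformlyOn
      (fun (P : MvPolynomial ℕ ℂ) (q : ℝ × Torus) => MvPolynomial.eval (boundaryMap q.1 q.2) P)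
      (fun q => value F (boundaryMap q.1 q.2)) (approx F) (Set.Ici θ ×ˢ Set.univ) := by
    rw [Metric.tendstoUniformlyOn_iff]
    intro ε hε
    have h0 : Tendsto (fun P => C * ‖polyLp p 0 P - F‖) (approx F) (𝓝 (C * ‖F - F‖)) :=
      ((tendsto_polyLp_approx F).sub_const F).norm.const_mul C
    rw [sub_self, norm_zero, mul_zero] at h0
    filter_upwards [h0.eventually (gt_mem_nhds hε)] with P hP q hq
    rw [dist_comm, dist_eq_norm]
    exact (hC q.1 hq.1 q.2 P).trans_lt hP
  refine hunif.continuousOn (Eventually.frequently (Eventually.of_forall fun P => ?_))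
  refine (continuous_eval P).comp_continuousOn (continuous_pi fun j => ?_).continuousOn
  have h1 : ∀ q : ℝ × Torus, (primeSeq j : ℝ) ≠ 0 := fun _ =>
    (zero_lt_one.trans (one_lt_primeSeq j)).ne'
  unfold boundaryMap
  have h2 : Continuous fun q : ℝ × Torus => ((primeSeq j : ℝ) ^ (-q.1) : ℝ) :=
    continuous_const.rpow continuous_fst.neg fun q => Or.inl (h1 q)
  fun_prop

theorem continuous_value_boundaryMap (hp : 2 ≤ p) {F : Lp ℂ p haar} (hF : F ∈ hardySpace p)
    {θ : ℝ} (hθ : 1 / 2 < θ) : Continuous fun τ : Torus => value F (boundaryMap θ τ) := by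
  have h := (continuousOn_value_boundaryMap hp hF hθ).comp_continuous
    (f := fun τ : Torus => (θ, τ)) (by fun_prop)
    fun τ => Set.mk_mem_prod Set.self_mem_Ici (Set.mem_univ τ)
  exact h

theorem continuousAt_value_boundaryMap (hp : 2 ≤ p) {F : Lp ℂ p haar} (hF : F ∈ hardySpace p)
    (τ : Torus) {θ : ℝ} (hθ : 1 / 2 < θ) :
    ContinuousAt (fun θ : ℝ => value F (boundaryMap θ τ)) θ := by
  obtain ⟨θ', h1, h2⟩ := exists_between hθ
  have : ContinuousOn (fun θ : ℝ => value F (boundaryMap θ τ)) (Set.Ici θ') := by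
    have h := (continuousOn_value_boundaryMap hp hF h1).comp (s := Set.Ici θ')
      (f := fun θ : ℝ => (θ, τ)) (by fun_prop)
      fun θ hθ => Set.mk_mem_prod hθ (Set.mem_univ τ)
    exact h
  exact this.continuousAt (Ici_mem_nhds h2)

/-! ### Boundary functions on orbits of the Kronecker flow -/

theorem continuous_eval_kroneckerFlow (θ : ℝ) (τ : Torus) (P : MvPolynomial ℕ ℂ) :
    Continuous fun u : ℝ => MvPolynomial.eval (boundaryMap θ (kroneckerFlow u τ)) P :=
  (continuous_eval P).comp ((continuous_boundaryMap θ).comp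
    (continuous_kroneckerFlow.comp (Continuous.prodMk_left τ)))

theorem norm_eval_boundaryMap_le (θ : ℝ) (τ : Torus) (P : MvPolynomial ℕ ℂ) :
    ‖MvPolynomial.eval (boundaryMap θ τ) P‖ ≤ ‖polyMap θ P‖ := by
  rw [← polyMap_apply]
  exact (polyMap θ P).norm_coe_le_norm τ

theorem integrable_poissonKernel_mul_eval (τ : Torus) (P : MvPolynomial ℕ ℂ) :
    Integrable fun u : ℝ => (poissonKernel 1 u : ℂ) *
      MvPolynomial.eval (boundaryMap (1 / 2) (kroneckerFlow u τ)) P :=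
  (integrable_poissonKernel one_pos).ofReal.mul_bdd
    (continuous_eval_kroneckerFlow _ τ P).aestronglyMeasurable
    (ae_of_all _ fun _ => norm_eval_boundaryMap_le _ _ P)

/-- The boundary values `u ↦ P(b_{1/2}(T_u τ))` on the orbit of `τ`, multiplied by the Poisson
kernel at height `1` so as to be integrable over the line. -/
def orbitMap (τ : Torus) : MvPolynomial ℕ ℂ →ₗ[ℂ] (ℝ →₁[volume] ℂ) where
  toFun P := (integrable_poissonKernel_mul_eval τ P).toL1 _
  map_add' P Q := by
    rw [← Integrable.toL1_add]
    congr 1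
    ext u
    simp [mul_add]
  map_smul' c P := by
    rw [RingHom.id_apply, ← Integrable.toL1_smul]
    congr 1
    ext u
    simp
    ring

theorem norm_orbitMap_le (hp : 2 ≤ p) (τ : Torus) (P : MvPolynomial ℕ ℂ) :
    ‖orbitMap τ P‖ ≤ 2 * ‖polyLp p 0 P‖ := by
  set N := ‖polyLp p 0 P‖ with hN
  set f : ℝ → ℂ := fun u => MvPolynomial.eval (boundaryMap (1 / 2) (kroneckerFlow u τ)) P with hf
  have hnorm : ‖orbitMap τ P‖ = ∫ u, poissonKernel 1 u * ‖f u‖ := by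
    change ‖(integrable_poissonKernel_mul_eval τ P).toL1 _‖ = _
    rw [L1.norm_eq_integral_norm]
    refine integral_congr_ae ?_
    filter_upwards [(integrable_poissonKernel_mul_eval τ P).coeFn_toL1] with u hu
    rw [hu, norm_mul, Complex.norm_of_nonneg (poissonKernel_nonneg zero_le_one u)]
  have hsq : ∫ u, poissonKernel 1 u * ‖f u‖ ^ 2 ≤ 3 * N ^ 2 :=
    (integral_poissonKernel_mul_norm_sq_le τ P).trans
      (mul_le_mul_of_nonneg_left (sum_norm_coeff_sq_le hp P) (by norm_num))
  have hcont : Continuous f := continuous_eval_kroneckerFlow _ τ P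
  have hi1 : Integrable fun u => poissonKernel 1 u * ‖f u‖ := by
    refine (integrable_poissonKernel one_pos).mul_bdd (c := ‖polyMap (1 / 2) P‖)
      hcont.norm.aestronglyMeasurable (ae_of_all _ fun u => ?_)
    rw [norm_norm]
    exact norm_eval_boundaryMap_le _ _ P
  have hi2 : Integrable fun u => poissonKernel 1 u * ‖f u‖ ^ 2 := by
    refine (integrable_poissonKernel one_pos).mul_bdd (c := ‖polyMap (1 / 2) P‖ ^ 2)
      (hcont.norm.pow 2).aestronglyMeasurable (ae_of_all _ fun u => ?_)
    rw [norm_pow, norm_norm]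
    gcongr
    exact norm_eval_boundaryMap_le _ _ P
  -- integrating `‖f‖ ≤ a / 2 + ‖f‖² / (2 a)` replaces the Cauchy–Schwarz inequality; taking `a > N`
  -- instead of `a = N` covers the case `N = 0`
  rw [hnorm, ← div_le_iff₀' two_pos]
  refine le_of_forall_gt_imp_ge_of_dense fun a ha => ?_
  have ha0 : 0 < a := (norm_nonneg _).trans_lt ha
  have hN0 : 0 ≤ N := norm_nonneg _
  have hle : ∫ u, poissonKernel 1 u * ‖f u‖ ≤
      ∫ u, (a / 2 * poissonKernel 1 u + 1 / (2 * a) * (poissonKernel 1 u * ‖f u‖ ^ 2)) := by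
    refine integral_mono hi1 (((integrable_poissonKernel one_pos).const_mul _).add
      (hi2.const_mul _)) fun u => ?_
    have hk := poissonKernel_nonneg zero_le_one u
    have : ‖f u‖ ≤ a / 2 + 1 / (2 * a) * ‖f u‖ ^ 2 := by
      have : a / 2 + 1 / (2 * a) * ‖f u‖ ^ 2 - ‖f u‖ = (a - ‖f u‖) ^ 2 / (2 * a) := by
        field_simp
        ring
      have : 0 ≤ (a - ‖f u‖) ^ 2 / (2 * a) := by positivity
      linarith
    simp only
    nlinarith [mul_le_mul_of_nonneg_left this hk]
  rw [integral_add ((integrable_poissonKernel one_pos).const_mul _) (hi2.const_mul _),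
    integral_const_mul, integral_const_mul, integral_poissonKernel one_pos] at hle
  have h3 : 1 / (2 * a) * ∫ u, poissonKernel 1 u * ‖f u‖ ^ 2 ≤ 1 / (2 * a) * (3 * a ^ 2) := by
    gcongr
    refine hsq.trans ?_
    gcongr
  have h4 : 1 / (2 * a) * (3 * a ^ 2) = 3 / 2 * a := by field_simp
  linarith

/-- On each orbit of the Kronecker flow, `F` is the Poisson integral of a boundary function. -/
theorem exists_value_eq_integral_poissonKernel (hp : 2 ≤ p) {F : Lp ℂ p haar}
    (hF : F ∈ hardySpace p) (τ : Torus) :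
    ∃ g : ℝ → ℂ, Integrable (fun u => (poissonKernel 1 u : ℂ) * g u) ∧
      ∀ y, 0 < y → ∀ t, value F (boundaryMap (1 / 2 + y) (kroneckerFlow t τ)) =
        ∫ u, (poissonKernel y (u - t) : ℂ) * g u := by
  have hne : (approx F).NeBot := (approx_neBot_iff F).2 hF
  have hG := tendsto_limUnder_approx hF (orbitMap τ) 2 (norm_orbitMap_le hp τ)
  set G : ℝ →₁[volume] ℂ := limUnder (approx F) (orbitMap τ) with hGdef
  have hk : ∀ u, (poissonKernel 1 u : ℂ) ≠ 0 := fun u =>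
    Complex.ofReal_ne_zero.2 (poissonKernel_pos one_pos u).ne'
  refine ⟨fun u => (poissonKernel 1 u : ℂ)⁻¹ * G u, ?_, fun y hy t => ?_⟩
  · simp_rw [mul_inv_cancel_left₀ (hk _)]
    exact L1.integrable_coeFn G
  · have hc1 := continuous_poissonKernel one_pos
    have hc2 := continuous_poissonKernel hy
    set m : ℝ → ℂ := fun u => (poissonKernel y (u - t) : ℂ) / (poissonKernel 1 u : ℂ) with hm
    have hmc : Continuous m := Continuous.div (by fun_prop) (by fun_prop) hk
    set C := y * ((1 + 2 * t ^ 2) / y ^ 2 + 2) with hC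
    have hmC : ∀ u, ‖m u‖ ≤ C := fun u => by
      rw [hm, norm_div, Complex.norm_of_nonneg (poissonKernel_nonneg hy.le _),
        Complex.norm_of_nonneg (poissonKernel_nonneg zero_le_one _),
        div_le_iff₀ (poissonKernel_pos one_pos u)]
      exact poissonKernel_sub_le hy t u
    have hint : ∀ H : ℝ →₁[volume] ℂ, Integrable fun u => m u * H u := fun H =>
      (L1.integrable_coeFn H).bdd_mul hmc.aestronglyMeasurable (ae_of_all _ hmC)
    -- integration against the bounded function `m` is continuous on `L¹`
    have hlim : Tendsto (fun P => ∫ u, m u * orbitMap τ P u) (approx F)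
        (𝓝 (∫ u, m u * G u)) := by
      rw [tendsto_iff_norm_sub_tendsto_zero]
      have h0 : Tendsto (fun P => C * ‖orbitMap τ P - G‖) (approx F) (𝓝 (C * ‖G - G‖)) :=
        (hG.sub_const G).norm.const_mul C
      rw [sub_self, norm_zero, mul_zero] at h0
      refine squeeze_zero (fun _ => norm_nonneg _) (fun P => ?_) h0
      rw [← integral_sub (hint _) (hint _), L1.norm_eq_integral_norm, ← integral_const_mul]
      refine norm_integral_le_of_norm_le ((L1.integrable_coeFn _).norm.const_mul _) ?_
      filter_upwards [Lp.coeFn_sub (orbitMap τ P) G] with u hu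
      rw [hu, Pi.sub_apply, ← mul_sub, norm_mul]
      gcongr
      exact hmC u
    have hpoly : ∀ P, ∫ u, m u * orbitMap τ P u =
        MvPolynomial.eval (boundaryMap (1 / 2 + y) (kroneckerFlow t τ)) P := by
      intro P
      rw [← integral_poissonKernel_mul_eval (1 / 2) hy,
        ← integral_sub_right_eq_self (fun u => (poissonKernel y u : ℂ) *
          MvPolynomial.eval (boundaryMap (1 / 2) (kroneckerFlow u (kroneckerFlow t τ))) P) t]
      refine integral_congr_ae ?_
      filter_upwards [(integrable_poissonKernel_mul_eval τ P).coeFn_toL1] with u hu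
      have hu' : (orbitMap τ P : ℝ → ℂ) u = _ := hu
      rw [hu', hm, ← kroneckerFlow_add, sub_add_cancel]
      have := hk u
      field_simp
    have hval := tendsto_value_boundaryMap hp hF (by linarith : 1 / 2 < 1 / 2 + y)
      (kroneckerFlow t τ)
    rw [tendsto_nhds_unique hval (hlim.congr hpoly)]
    congr 1
    ext u
    rw [hm]
    ring

/-- On every orbit of the Kronecker flow the radial limits exist almost everywhere. -/
theorem ae_exists_tendsto_value_kroneckerFlow (hp : 2 ≤ p) {F : Lp ℂ p haar}
    (hF : F ∈ hardySpace p) (τ : Torus) : ∀ᵐ t : ℝ, ∃ c,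
      Tendsto (fun θ : ℝ => value F (boundaryMap θ (kroneckerFlow t τ))) (𝓝[>] (1 / 2)) (𝓝 c) := by
  obtain ⟨g, hg, hval⟩ := exists_value_eq_integral_poissonKernel hp hF τ
  filter_upwards [ae_tendsto_integral_poissonKernel hg] with t ht
  refine ⟨g t, ?_⟩
  have hsub : Tendsto (fun θ : ℝ => θ - 1 / 2) (𝓝[>] (1 / 2)) (𝓝[>] 0) := by
    refine tendsto_nhdsWithin_iff.2 ⟨?_, ?_⟩
    · have : Tendsto (fun θ : ℝ => θ - 1 / 2) (𝓝 (1 / 2)) (𝓝 (1 / 2 - 1 / 2)) :=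
        tendsto_id.sub_const _
      rw [sub_self] at this
      exact this.mono_left nhdsWithin_le_nhds
    · filter_upwards [self_mem_nhdsWithin] with θ hθ
      exact sub_pos.2 (Set.mem_Ioi.1 hθ)
  refine (ht.comp hsub).congr' ?_
  filter_upwards [self_mem_nhdsWithin] with θ hθ
  have hθ : 1 / 2 < θ := hθ
  rw [Function.comp_apply, ← hval _ (sub_pos.2 hθ) t, add_sub_cancel]

/-! ### Almost every point of the torus -/

/-- For a function continuous on `(a, ∞)`, a right limit at `a` along the rationals is a right
limit. -/
theorem tendsto_nhdsGT_of_tendsto_rat {φ : ℝ → ℂ} {a : ℝ} (hφ : ∀ θ, a < θ → ContinuousAt φ θ)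
    {c : ℂ} (h : Tendsto (fun q : {q : ℚ // a < q} => φ (q : ℚ))
      (comap (fun q : {q : ℚ // a < q} => ((q : ℚ) : ℝ)) (𝓝[>] a)) (𝓝 c)) :
    Tendsto φ (𝓝[>] a) (𝓝 c) := by
  rw [(closed_nhds_basis c).tendsto_right_iff]
  rintro V ⟨hV, hVc⟩
  obtain ⟨U, hU, hUV⟩ := h hV
  obtain ⟨b, hb, hbU⟩ := mem_nhdsGT_iff_exists_Ioo_subset.1 hU
  filter_upwards [Ioo_mem_nhdsGT hb] with θ hθ
  by_contra hθV
  have h1 : ∀ᶠ x in 𝓝 θ, φ x ∈ Vᶜ := hφ θ hθ.1 (hVc.isOpen_compl.mem_nhds hθV)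
  obtain ⟨_, ⟨q, rfl⟩, hx1⟩ := (Rat.denseRange_cast (𝕜 := ℝ)).inter_nhds_nonempty
    (h1.and (Ioo_mem_nhds hθ.1 hθ.2))
  exact hx1.1 (hUV (a := ⟨q, hx1.2.1⟩) (hbU hx1.2))

theorem measurableSet_exists_tendsto_value (hp : 2 ≤ p) {F : Lp ℂ p haar}
    (hF : F ∈ hardySpace p) : MeasurableSet {τ : Torus | ∃ c,
      Tendsto (fun θ : ℝ => value F (boundaryMap θ τ)) (𝓝[>] (1 / 2)) (𝓝 c)} := by
  have h := measurableSet_exists_tendsto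
    (l := comap (fun q : {q : ℚ // (1 / 2 : ℝ) < q} => ((q : ℚ) : ℝ)) (𝓝[>] (1 / 2)))
    (f := fun (q : {q : ℚ // (1 / 2 : ℝ) < q}) (τ : Torus) =>
      value F (boundaryMap ((q : ℚ) : ℝ) τ))
    fun q => (continuous_value_boundaryMap hp hF q.2).measurable
  convert h using 1
  ext τ
  exact ⟨fun ⟨c, hc⟩ => ⟨c, hc.comp tendsto_comap⟩, fun ⟨c, hc⟩ => ⟨c,
    tendsto_nhdsGT_of_tendsto_rat (fun θ hθ => continuousAt_value_boundaryMap hp hF τ hθ) hc⟩⟩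

/-- A measurable set containing almost every point of every orbit of the Kronecker flow has
full measure. -/
theorem ae_mem_of_forall_ae_kroneckerFlow {E : Set Torus} (hE : MeasurableSet E)
    (h : ∀ τ : Torus, ∀ᵐ t : ℝ, kroneckerFlow t τ ∈ E) : ∀ᵐ τ ∂haar, τ ∈ E := by
  have hmeas : MeasurableSet {x : Torus × ℝ | kroneckerFlow x.2 x.1 ∈ E} :=
    (continuous_kroneckerFlow.comp continuous_swap).measurable hE
  have h2 : ∀ᵐ t : ℝ, ∀ᵐ τ ∂haar, kroneckerFlow t τ ∈ E :=
    (Measure.ae_ae_comm hmeas).1 (ae_of_all _ h)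
  obtain ⟨t, ht⟩ := h2.exists
  rw [ae_iff] at ht ⊢
  change haar Eᶜ = 0
  rw [← (measurePreserving_kroneckerFlow t).measure_preimage hE.compl.nullMeasurableSet]
  exact ht

theorem ae_exists_tendsto_value (hp : 2 ≤ p) {F : Lp ℂ p haar} (hF : F ∈ hardySpace p) :
    ∀ᵐ τ ∂haar, ∃ c,
      Tendsto (fun θ : ℝ => value F (boundaryMap θ τ)) (𝓝[>] (1 / 2)) (𝓝 c) :=
  ae_mem_of_forall_ae_kroneckerFlow (measurableSet_exists_tendsto_value hp hF)
    fun τ => ae_exists_tendsto_value_kroneckerFlow hp hF τ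

/-! ### Identification of the limit -/

/-- For `θ > 1/2` the restriction, defined as an `L^p` limit, is given by the point values. -/
theorem restriction_eq_toLp (hp : 2 ≤ p) {F : Lp ℂ p haar} (hF : F ∈ hardySpace p) {θ : ℝ}
    (hθ : 1 / 2 < θ) :
    restriction θ F = ContinuousMap.toLp (E := ℂ) p haar ℂ
      ⟨fun τ => value F (boundaryMap θ τ), continuous_value_boundaryMap hp hF hθ⟩ := by
  have hne : (approx F).NeBot := (approx_neBot_iff F).2 hF
  obtain ⟨C, hC⟩ := exists_norm_eval_sub_value_le hp hF hθ
  refine tendsto_nhds_unique (tendsto_restriction (by linarith) hF) ?_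
  refine ((ContinuousMap.toLp (E := ℂ) p haar ℂ).continuous.tendsto _).comp
    (f := fun P => polyMap θ P) ?_
  rw [tendsto_iff_norm_sub_tendsto_zero]
  have h0 : Tendsto (fun P => |C| * ‖polyLp p 0 P - F‖) (approx F) (𝓝 (|C| * ‖F - F‖)) :=
    ((tendsto_polyLp_approx F).sub_const F).norm.const_mul _
  rw [sub_self, norm_zero, mul_zero] at h0
  refine squeeze_zero (fun _ => norm_nonneg _) (fun P => ?_) h0
  rw [ContinuousMap.norm_le _ (by positivity)]
  intro τ
  rw [ContinuousMap.sub_apply, polyMap_apply]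
  refine (hC θ le_rfl τ P).trans ?_
  gcongr
  exact le_abs_self C

theorem norm_polyLp_sub_restriction_le {θ : ℝ} (hθ : 0 ≤ θ) {F : Lp ℂ p haar}
    (hF : F ∈ hardySpace p) (P : MvPolynomial ℕ ℂ) :
    ‖polyLp p θ P - restriction θ F‖ ≤ ‖polyLp p 0 P - F‖ := by
  have := norm_sub_le_of_tendsto hF (polyLp p θ) (C := 1)
    (fun P => by rw [one_mul]; exact norm_polyLp_le hθ P) (tendsto_restriction hθ hF) P
  rwa [one_mul] at this

theorem continuous_polyLp (P : MvPolynomial ℕ ℂ) : Continuous fun θ : ℝ => polyLp p θ P := by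
  simp_rw [polyLp_eq_sum]
  refine continuous_finsetSum _ fun d _ => ?_
  have h2 : Continuous fun θ : ℝ => ((bohrIndex d : ℝ) ^ (-θ) : ℝ) :=
    continuous_const.rpow continuous_neg fun _ => Or.inl (by exact_mod_cast (bohrIndex_pos d).ne')
  have h3 : Continuous fun θ : ℝ => P.coeff d * (((bohrIndex d : ℝ) ^ (-θ) : ℝ) : ℂ) := by
    fun_prop
  exact h3.smul continuous_const

/-- The restrictions `F ∘ b_θ` depend continuously on `θ ≥ 0` in `L^p`. -/
theorem continuousOn_restriction {F : Lp ℂ p haar} (hF : F ∈ hardySpace p) :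
    ContinuousOn (fun θ : ℝ => restriction θ F) (Set.Ici 0) := by
  have hne : (approx F).NeBot := (approx_neBot_iff F).2 hF
  have hunif : TendstoUniformlyOn (fun (P : MvPolynomial ℕ ℂ) (θ : ℝ) => polyLp p θ P)
      (fun θ => restriction θ F) (approx F) (Set.Ici 0) := by
    rw [Metric.tendstoUniformlyOn_iff]
    intro ε hε
    filter_upwards [(tendsto_polyLp_approx F).eventually (Metric.ball_mem_nhds F hε)]
      with P hP θ hθ
    rw [dist_comm, dist_eq_norm]
    refine (norm_polyLp_sub_restriction_le hθ hF P).trans_lt ?_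
    rwa [← dist_eq_norm]
  exact hunif.continuousOn (Eventually.frequently (Eventually.of_forall fun P =>
    (continuous_polyLp P).continuousOn))

end HardyTorus

end

open HardyTorus in
theorem theorem10 (p : ℝ≥0∞) [Fact (1 ≤ p)] (hp : 2 ≤ p) (hp_top : p ≠ ∞)
    (F : Lp ℂ p haar) (hF : F ∈ hardySpace p) :
    -- the values of `F` on `𝔻^∞ ∩ ℓ²` are well defined
    (∀ z : ℕ → ℂ, (∀ j, ‖z j‖ < 1) → Summable (fun j => ‖z j‖ ^ 2) →
      Tendsto (fun P => MvPolynomial.eval z P) (approx F) (𝓝 (value F z))) ∧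
    -- the restriction of `F` to `𝕋^∞_{1/2}` is well defined
    Tendsto (fun P => polyLp p (1 / 2) P) (approx F) (𝓝 (restriction (1 / 2) F)) ∧
    -- it has a representative with the stated boundary behaviour
    ∃ Ft : Torus → ℂ, Measurable Ft ∧ Ft =ᵐ[haar] restriction (1 / 2) F ∧
      (∀ᵐ τ ∂haar,
        Tendsto (fun θ : ℝ => value F (boundaryMap θ τ)) (𝓝[>] (1 / 2)) (𝓝 (Ft τ))) ∧
      ∀ τ : Torus, ∀ᵐ t : ℝ,
        Tendsto (fun θ : ℝ => value F (boundaryMap θ (kroneckerFlow t τ))) (𝓝[>] (1 / 2))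
          (𝓝 (Ft (kroneckerFlow t τ))) := by
  refine ⟨fun z hz1 hz => tendsto_value hp hF hz1 hz, tendsto_restriction (by norm_num) hF, ?_⟩
  set s : ℕ → ℝ := fun n => 1 / 2 + 1 / ((n : ℝ) + 1) with hs
  have hs1 : ∀ n, 1 / 2 < s n := fun n => by
    have : (0 : ℝ) < 1 / ((n : ℝ) + 1) := by positivity
    rw [hs]
    linarith
  have hs0 : Tendsto s atTop (𝓝[>] (1 / 2)) := by
    refine tendsto_nhdsWithin_iff.2 ⟨?_, Eventually.of_forall hs1⟩
    have := (tendsto_one_div_add_atTop_nhds_zero_nat (𝕜 := ℝ)).const_add (1 / 2)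
    rwa [add_zero] at this
  set Ft : Torus → ℂ := fun τ => limUnder atTop fun n => value F (boundaryMap (s n) τ) with hFt
  have hFtm : Measurable Ft := (StronglyMeasurable.limUnder fun n =>
    (continuous_value_boundaryMap hp hF (hs1 n)).measurable.stronglyMeasurable).measurable
  -- wherever the full radial limit exists, it is found along the sequence `s`
  have hlim : ∀ τ : Torus, (∃ c,
      Tendsto (fun θ : ℝ => value F (boundaryMap θ τ)) (𝓝[>] (1 / 2)) (𝓝 c)) →
      Tendsto (fun θ : ℝ => value F (boundaryMap θ τ)) (𝓝[>] (1 / 2)) (𝓝 (Ft τ)) := by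
    rintro τ ⟨c, hc⟩
    have : Ft τ = c := (hc.comp hs0).limUnder_eq
    rwa [this]
  have hae : ∀ᵐ τ ∂haar,
      Tendsto (fun θ : ℝ => value F (boundaryMap θ τ)) (𝓝[>] (1 / 2)) (𝓝 (Ft τ)) := by
    filter_upwards [ae_exists_tendsto_value hp hF] with τ hτ using hlim τ hτ
  refine ⟨Ft, hFtm, ?_, hae, fun τ => ?_⟩
  · -- a subsequence of the `L^p`-convergent restrictions converges almost everywhere
    have hLp : Tendsto (fun n => restriction (s n) F) atTop (𝓝 (restriction (1 / 2) F)) := by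
      have h1 := (continuousOn_restriction hF).continuousAt
        (Ici_mem_nhds (by norm_num : (0 : ℝ) < 1 / 2))
      exact h1.tendsto.comp (hs0.mono_right nhdsWithin_le_nhds)
    obtain ⟨ns, hns, hsub⟩ := (tendstoInMeasure_of_tendsto_Lp hLp).exists_seq_tendsto_ae
    have hrep : ∀ᵐ τ ∂haar, ∀ n, restriction (s n) F τ = value F (boundaryMap (s n) τ) := by
      rw [ae_all_iff]
      intro n
      rw [restriction_eq_toLp hp hF (hs1 n)]
      exact ContinuousMap.coeFn_toLp haar _
    filter_upwards [hsub, hrep, hae] with τ h1 h2 h3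
    refine tendsto_nhds_unique ((h3.comp hs0).comp hns.tendsto_atTop) (h1.congr fun n => ?_)
    exact h2 _
  · filter_upwards [ae_exists_tendsto_value_kroneckerFlow hp hF τ] with t ht using hlim _ ht
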